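/- Consider the stationary $M/M/1$ processor-sharing queue with Poisson arrivals of rate $\rho\in(0,1)$ and independent exponential service requirements of mean $1$: while $m$ customers are present, each receives the fraction $1/m$ of the server. Let $\mathbf V$ be the sojourn time of a tagged customer and $\mathbf N$ the number of other customers present at its arrival, so that $\Pr[\mathbf N=n]=(1-\rho)\rho^n$. Explicitly, the number of other customers present during the tagged customer's stay is the Markov jump process that starts at $\mathbf N$ and in state $n$ moves to $n+1$ at rate $\rho$, to $n-1$ at rate $n/(n+1)$, and is stopped (the tagged customer departs) at rate $1/(n+1)$; $\mathbf V$ is the time until it is stopped. Then $\mathbf V<\infty$ almost surely, and for each $n\ge 0$ the conditional law of $\mathbf V$ given $\mathbf N=n$ has a density $p_n$ on $(0,\infty)$. Let $\theta\in\mathbb C$ with $\operatorname{Re}\theta>-(1-\sqrt\rho)^2$, and put $$z_\pm=\frac{1}{2\rho}\Big[1+\rho+\theta\pm\sqrt{(1+\rho+\theta)^2-4\rho}\Big],\qquad \alpha=\frac{z_+}{z_+-z_-},\qquad M=z_-\Big(\frac{z_+}{z_-}\Big)^{\alpha},$$ $$G_n=\int_0^{z_-}z^n(z_+-z)^{-\alpha}(z_--z)^{\alpha-1}\,dz,\qquad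 H_n=\frac{e^{i\alpha\pi}}{2\pi i}\int_{\mathscr C}z^n(z_+-z)^{-\alpha}(z-z_-)^{\alpha-1}\,dz .$$ Here the square root and the powers in $M$ and $G_n$ are principal, $G_n$ is taken over the straight segment $[0,z_-]$ (part of the real axis if $\theta$ is real), and $\mathscr C$ is any closed contour in $\mathbb C\setminus[z_-,z_+]$ that encircles the segment $[z_-,z_+]$ once counterclockwise. In $H_n$, $(z_+-z)^{-\alpha}(z-z_-)^{\alpha-1}$ denotes the branch holomorphic off $[z_-,z_+]$ given by $e^{-i\alpha\pi}(z-z_-)^{-1}\big(\tfrac{z-z_+}{z-z_-}\big)^{-\alpha}$ with the principal power; for real $\theta$ it is the one that is positive on the lower side of the segment. Then the integrals defining $\widehat p_n(\theta)=\int_0^\infty p_n(t)e^{-\theta t}\,dt$ and $G_n$, and the series $\sum_l\rho^lG_l$, converge absolutely, and for all $n\ge0$ $$\widehat p_n(\theta)=M\,G_n\sum_{l=0}^n\rho^lH_l+M\,H_n\sum_{l=n+1}^\infty\rho^lG_l .$$ Moreover $(\widehat p_n(\theta))_{n\ge0}$ satisfies $$(n+1)\rho\,\widehat p_{n+1}(\theta)-(n+1)(1+\rho+\theta)\,\widehat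 p_n(\theta)+n\,\widehat p_{n-1}(\theta)=-1,\qquad n\ge0$$ (the last term on the left being absent for $n=0$), and it is the only solution of this recurrence that is $O(\rho^{-n/2})$ as $n\to\infty$. -/

import Mathlib

open MeasureTheory ProbabilityTheory Set
open scoped ENNReal

namespace MM1PS

noncomputable section

/-! ### The M/M/1 processor-sharing queue, seen by a tagged customer -/

/-- State of the queue after the arrival of the tagged customer: either the tagged customer is still
present together with `n` other customers, or the tagged customer has departed. -/
inductive State where
  | present (n : ℕ) : State
  | departed : State
  deriving DecidableEq

instance : MeasurableSpace State := ⊤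

/-- Transition rates. Customers arrive at rate `ρ`; service requirements are exponential of mean `1`
and, while `n + 1` customers are present, each of them receives the fraction `1 / (n + 1)` of the
server, so each completes its service at rate `1 / (n + 1)`. -/
def rate (ρ : ℝ) : State → State → ℝ
  | .present n, .present m =>
      if m = n + 1 then ρ else if m + 1 = n then n * (1 / (n + 1)) else 0
  | .present n, .departed => 1 / (n + 1)
  | .departed, _ => 0

/-- Total rate of leaving a state. -/
def exitRate (ρ : ℝ) (x : State) : ℝ := ∑' y, rate ρ x y

/-- Transition probabilities of the embedded jump chain (a state with exit rate `0` is absorbing). -/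
def jumpProb (ρ : ℝ) (x y : State) : ℝ :=
  if exitRate ρ x = 0 then (if y = x then 1 else 0) else rate ρ x y / exitRate ρ x

/-- The Markov jump process with the rates above, given by its jump chain `X` and its holding
times: the time spent in the `k`-th visited state `X k` is `E k / exitRate ρ (X k)`, where the `E k`
are i.i.d. standard exponential and independent of the chain. The number of other customers found by
the tagged customer has the stationary (geometric) distribution. -/
structure IsTaggedQueue {Ω : Type*} [MeasurableSpace Ω] (P : Measure Ω) (ρ : ℝ)
    (X : ℕ → Ω → State) (E : ℕ → Ω → ℝ) : Prop where
  measurable_X : ∀ k, Measurable (X k)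
  measurable_E : ∀ k, Measurable (E k)
  initial : ∀ n : ℕ, P {ω | X 0 ω = .present n} = ENNReal.ofReal ((1 - ρ) * ρ ^ n)
  markov : ∀ (k : ℕ) (x : ℕ → State),
    P {ω | ∀ i ≤ k + 1, X i ω = x i} =
      P {ω | ∀ i ≤ k, X i ω = x i} * ENNReal.ofReal (jumpProb ρ (x k) (x (k + 1)))
  law_E : ∀ k, P.map (E k) = expMeasure 1
  iIndep_E : iIndepFun E P
  indep : IndepFun (fun ω k => X k ω) (fun ω k => E k ω) P

/-- The sojourn time of the tagged customer: the total time during which it is present. -/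
def sojournTime {Ω : Type*} (ρ : ℝ) (X : ℕ → Ω → State) (E : ℕ → Ω → ℝ) (ω : Ω) : ℝ≥0∞ :=
  ∑' k, if X k ω = .departed then 0 else ENNReal.ofReal (E k ω / exitRate ρ (X k ω))

/-- Conditional law of the sojourn time, given that the tagged customer finds `n` others. -/
def condLaw {Ω : Type*} [MeasurableSpace Ω] (P : Measure Ω) (ρ : ℝ)
    (X : ℕ → Ω → State) (E : ℕ → Ω → ℝ) (n : ℕ) : Measure ℝ :=
  (ProbabilityTheory.cond P {ω | X 0 ω = .present n}).map
    fun ω => (sojournTime ρ X E ω).toReal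

/-- Conditional sojourn-time density `p_n(t)`. -/
def density {Ω : Type*} [MeasurableSpace Ω] (P : Measure Ω) (ρ : ℝ)
    (X : ℕ → Ω → State) (E : ℕ → Ω → ℝ) (n : ℕ) (t : ℝ) : ℝ :=
  ((condLaw P ρ X E n).rnDeriv volume t).toReal

/-- Laplace transform `∫₀^∞ f(t) e^{-θ t} dt`. -/
def laplace (f : ℝ → ℝ) (θ : ℂ) : ℂ :=
  ∫ t in Ioi (0 : ℝ), (f t : ℂ) * Complex.exp (-θ * t)

/-- `(n+1) ρ q_{n+1} - (n+1) (1+ρ+θ) q_n + n q_{n-1} = -1` for all `n ≥ 0`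
(at `n = 0` the last term on the left is absent, being multiplied by `0`). -/
def SolvesRecurrence (ρ : ℝ) (θ : ℂ) (q : ℕ → ℂ) : Prop :=
  ∀ n : ℕ, ((n : ℂ) + 1) * ρ * q (n + 1) - ((n : ℂ) + 1) * (1 + ρ + θ) * q n
    + (n : ℂ) * q (n - 1) = -1

/-! ### The explicit functions -/

/-- The larger root of `ρ z² - (1 + ρ + θ) z + 1` (principal square root). -/
def zPlus (ρ : ℝ) (θ : ℂ) : ℂ :=
  1 / (2 * ρ) * (1 + ρ + θ + ((1 + ρ + θ) ^ 2 - 4 * ρ) ^ (1 / 2 : ℂ))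

/-- The smaller root of `ρ z² - (1 + ρ + θ) z + 1` (principal square root). -/
def zMinus (ρ : ℝ) (θ : ℂ) : ℂ :=
  1 / (2 * ρ) * (1 + ρ + θ - ((1 + ρ + θ) ^ 2 - 4 * ρ) ^ (1 / 2 : ℂ))

def alpha (ρ : ℝ) (θ : ℂ) : ℂ := zPlus ρ θ / (zPlus ρ θ - zMinus ρ θ)

def M (ρ : ℝ) (θ : ℂ) : ℂ := zMinus ρ θ * (zPlus ρ θ / zMinus ρ θ) ^ alpha ρ θ

/-- `z^n (z₊ - z)^{-α} (z₋ - z)^{α-1}` with principal powers. -/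
def gIntegrand (ρ : ℝ) (θ : ℂ) (n : ℕ) (z : ℂ) : ℂ :=
  z ^ n * (zPlus ρ θ - z) ^ (-alpha ρ θ) * (zMinus ρ θ - z) ^ (alpha ρ θ - 1)

/-- The integral of `gIntegrand` over the segment `[0, z₋]`, parametrized by `z = s z₋`. -/
def G (ρ : ℝ) (θ : ℂ) (n : ℕ) : ℂ :=
  ∫ s in (0 : ℝ)..1, gIntegrand ρ θ n (s * zMinus ρ θ) * zMinus ρ θ

/-- `∫_γ f(z) dz` for a curve `γ` parametrized by `[0, 1]`. -/
def contourIntegral (γ : ℝ → ℂ) (f : ℂ → ℂ) : ℂ :=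
  ∫ t in (0 : ℝ)..1, f (γ t) * deriv γ t

/-- `γ` is a closed contour that encircles the segment `[a, b]` once, counterclockwise. A vanishing
derivative is allowed, so that piecewise continuously differentiable contours are included after
reparametrization. The winding number is the same about all points of the segment. -/
structure IsContourAround (γ : ℝ → ℂ) (a b : ℂ) : Prop where
  contDiffOn : ContDiffOn ℝ 1 γ (Icc 0 1)
  closed : γ 0 = γ 1
  avoids : ∀ t ∈ Icc (0 : ℝ) 1, γ t ∉ segment ℝ a b
  winding : contourIntegral γ (fun z => (z - a)⁻¹) = 2 * Real.pi * Complex.I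

/-- The branch of `(z₊ - z)^{-α} (z - z₋)^{α-1}` that is holomorphic off the segment `[z₋, z₊]`
and takes its principal value on the lower side of the segment when `z₋ < z₊` are real. The quotient
`(z - z₊) / (z - z₋)` is in `(-∞, 0]` only on the segment, so the principal power is holomorphic
elsewhere; for `z` below the segment, `z₊ - z = e^{iπ} (z - z₊)` with arguments in `(-π, π)`. -/
def branch (ρ : ℝ) (θ : ℂ) (z : ℂ) : ℂ :=
  Complex.exp (-(Complex.I * alpha ρ θ * Real.pi)) *
    ((z - zMinus ρ θ)⁻¹ * ((z - zPlus ρ θ) / (z - zMinus ρ θ)) ^ (-alpha ρ θ))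

/-- `H_n` computed along the contour `γ`. -/
def H (ρ : ℝ) (θ : ℂ) (γ : ℝ → ℂ) (n : ℕ) : ℂ :=
  Complex.exp (Complex.I * alpha ρ θ * Real.pi) / (2 * Real.pi * Complex.I) *
    contourIntegral γ (fun z => z ^ n * branch ρ θ z)

end

end MM1PS

namespace MM1PS

/-! While the tagged customer is present, the total jump rate `ρ + n/(n+1) + 1/(n+1) = 1 + ρ` does
not depend on the state (`exitRate_present`). So, given `N = n`, the sojourn time is a mixture of
Erlang laws: departure occurs at jump `k + 1` with probability `exitProb ρ k n`, independently of
the i.i.d. holding times (`condLaw_eq_sum`). Its Laplace transform is the series `exitTransform`,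
and first-step analysis of the chain is the recurrence (`solvesRecurrence_exitTransform`).

Everything analytic uses the half-plane in the form `Re (1 + ρ + θ) > 2√ρ`. The sequence `ρ^(-n/2)`
is a supersolution of the one-step operator with factor `2√ρ/(1+ρ) < 1` (`step_supersolution`); this
yields almost sure departure, convergence of the transforms and their growth bound. In the
recurrence the same comparison is a contraction, so no nonzero homogeneous solution is `O(ρ^(-n/2))`
(`eq_zero_of_homogeneous`).

For the explicit formula, the combination of integrands of `G` or `H` occurring in the recurrence is
an exact derivative. Hence `H` solves the homogeneous equation, while `M * G` solves it except for a
defect `-1` at `n = 0`, coming from the endpoint `z = 0`. The Casoratian of the two is then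
explicit, and variation of constants (`solvesRecurrence_green`) gives a solution of the full
recurrence. It is identified with the transforms without estimating `H`: solutions are determined by
their value at `0`, and summation by parts against the decaying `M * G` shows that an admissible
solution has initial value `∑ ρ^l M G_l` (`zero_eq_tsum_of_solvesRecurrence`). The only value of `H`
needed is `H 0 = 1` (`H_zero`), which holds for every admissible contour. -/

/-! ### Roots of the characteristic quadratic and the exponent `alpha`. -/

lemma two_sqrt_lt_re {ρ : ℝ} (hρ0 : 0 < ρ) {θ : ℂ} (hθ : -(1 - √ρ) ^ 2 < θ.re) :
    2 * √ρ < (1 + ρ + θ).re := by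
  have := Real.sq_sqrt hρ0.le
  simp only [Complex.add_re, Complex.one_re, Complex.ofReal_re]
  nlinarith

lemma sq_sqrt_discr (ρ : ℝ) (θ : ℂ) :
    (((1 + ρ + θ) ^ 2 - 4 * ρ) ^ (1 / 2 : ℂ)) ^ 2 = (1 + ρ + θ) ^ 2 - 4 * ρ := by
  rw [one_div]
  exact_mod_cast Complex.cpow_nat_inv_pow _ two_ne_zero

/-- The principal root has nonnegative real part. If that part were zero, `w² - 4ρ` (with `w = 1 + ρ
+ θ`) would be real and nonpositive; as `Re w > 0`, `w` would be real, contradicting `w > 2√ρ`. -/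
lemma re_sqrt_discr_pos {ρ : ℝ} (hρ0 : 0 < ρ) {θ : ℂ} (hw : 2 * √ρ < (1 + ρ + θ).re) :
    0 < (((1 + ρ + θ) ^ 2 - 4 * ρ) ^ (1 / 2 : ℂ)).re := by
  have hsq := sq_sqrt_discr ρ θ
  have hnn : 0 ≤ (((1 + ρ + θ) ^ 2 - 4 * ρ) ^ (1 / 2 : ℂ)).re := by
    rw [one_div, Complex.cpow_inv_two_re]
    positivity
  set r := ((1 + ρ + θ) ^ 2 - 4 * ρ) ^ (1 / 2 : ℂ)
  set w := 1 + (ρ : ℂ) + θ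
  refine lt_of_le_of_ne hnn fun h0 => ?_
  have h1 := congrArg Complex.re hsq
  have h2 := congrArg Complex.im hsq
  simp only [pow_two, Complex.mul_re, Complex.mul_im, Complex.sub_re, Complex.sub_im,
    Complex.ofReal_re, Complex.ofReal_im, ← h0, zero_mul, mul_zero, zero_sub, Complex.re_ofNat,
    Complex.im_ofNat, add_zero, sub_zero] at h1 h2
  have hs := Real.sq_sqrt hρ0.le
  have hs0 := Real.sqrt_pos.2 hρ0
  have him : w.im = 0 := by
    have : w.re * w.im = 0 := by linarith
    rcases mul_eq_zero.1 this with h | h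
    · linarith
    · exact h
  rw [him] at h1
  nlinarith [sq_nonneg r.im]

lemma zPlus_add_zMinus {ρ : ℝ} (hρ0 : 0 < ρ) (θ : ℂ) :
    ρ * (zPlus ρ θ + zMinus ρ θ) = 1 + ρ + θ := by
  have : (ρ : ℂ) ≠ 0 := by exact_mod_cast hρ0.ne'
  unfold zPlus zMinus
  field_simp
  ring

lemma zPlus_mul_zMinus {ρ : ℝ} (hρ0 : 0 < ρ) (θ : ℂ) :
    ρ * (zPlus ρ θ * zMinus ρ θ) = 1 := by
  have : (ρ : ℂ) ≠ 0 := by exact_mod_cast hρ0.ne'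
  have hsq := sq_sqrt_discr ρ θ
  unfold zPlus zMinus
  set r := ((1 + ρ + θ) ^ 2 - 4 * ρ) ^ (1 / 2 : ℂ)
  field_simp
  linear_combination -hsq

lemma zPlus_sub_zMinus {ρ : ℝ} (hρ0 : 0 < ρ) (θ : ℂ) :
    ρ * (zPlus ρ θ - zMinus ρ θ) = ((1 + ρ + θ) ^ 2 - 4 * ρ) ^ (1 / 2 : ℂ) := by
  have : (ρ : ℂ) ≠ 0 := by exact_mod_cast hρ0.ne'
  unfold zPlus zMinus
  field_simp
  ring

/-- Real part of `z₋ = conj z₊ / (ρ |z₊|²)`, a form of `ρ z₊ z₋ = 1`. It transfers sign information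
between the roots and turns `Re z₋ < Re z₊` into `ρ |z₊|² > 1`. -/
lemma zMinus_re_eq {ρ : ℝ} (hρ0 : 0 < ρ) (θ : ℂ) :
    (zMinus ρ θ).re * (ρ * Complex.normSq (zPlus ρ θ)) = (zPlus ρ θ).re := by
  have h := zPlus_mul_zMinus hρ0 θ
  have h1 := congrArg Complex.re h
  have h2 := congrArg Complex.im h
  simp only [Complex.mul_re, Complex.mul_im, Complex.ofReal_re, Complex.ofReal_im, zero_mul,
    Complex.one_re, Complex.one_im] at h1 h2
  rw [Complex.normSq_apply]
  linear_combination (zPlus ρ θ).re * h1 + (zPlus ρ θ).im * h2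

lemma normSq_zPlus_pos {ρ : ℝ} (hρ0 : 0 < ρ) (θ : ℂ) : 0 < Complex.normSq (zPlus ρ θ) := by
  refine Complex.normSq_pos.2 fun h => ?_
  have := zPlus_mul_zMinus hρ0 θ
  simp [h] at this

lemma re_zPlus_pos {ρ : ℝ} (hρ0 : 0 < ρ) {θ : ℂ} (hw : 2 * √ρ < (1 + ρ + θ).re) :
    0 < (zPlus ρ θ).re := by
  have h1 := congrArg Complex.re (zPlus_add_zMinus hρ0 θ)
  have h3 := congrArg Complex.re (zPlus_sub_zMinus hρ0 θ)
  have h4 := re_sqrt_discr_pos hρ0 hw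
  have := Real.sqrt_nonneg ρ
  rw [← h3] at h4
  rw [Complex.re_ofReal_mul] at h1 h4
  simp only [Complex.sub_re, Complex.add_re] at h1 h4 hw
  rw [← h1] at hw
  have : 0 < ρ * (2 * (zPlus ρ θ).re) := by linarith
  have := pos_of_mul_pos_right this hρ0.le
  linarith

lemma re_zMinus_pos {ρ : ℝ} (hρ0 : 0 < ρ) {θ : ℂ} (hw : 2 * √ρ < (1 + ρ + θ).re) :
    0 < (zMinus ρ θ).re := by
  have h := re_zPlus_pos hρ0 hw
  rw [← zMinus_re_eq hρ0 θ] at h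
  exact pos_of_mul_pos_left h (mul_pos hρ0 (normSq_zPlus_pos hρ0 θ)).le

lemma re_zMinus_lt {ρ : ℝ} (hρ0 : 0 < ρ) {θ : ℂ} (hw : 2 * √ρ < (1 + ρ + θ).re) :
    (zMinus ρ θ).re < (zPlus ρ θ).re := by
  have h4 := re_sqrt_discr_pos hρ0 hw
  rw [← zPlus_sub_zMinus hρ0 θ, Complex.re_ofReal_mul, Complex.sub_re] at h4
  linarith [pos_of_mul_pos_right h4 hρ0.le]

lemma one_lt_norm_zPlus {ρ : ℝ} (hρ0 : 0 < ρ) {θ : ℂ} (hw : 2 * √ρ < (1 + ρ + θ).re) :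
    1 < √ρ * ‖zPlus ρ θ‖ := by
  have h1 := re_zMinus_pos hρ0 hw
  have h2 := re_zMinus_lt hρ0 hw
  rw [← zMinus_re_eq hρ0 θ, Complex.normSq_eq_norm_sq] at h2
  have h3 : 1 < ρ * ‖zPlus ρ θ‖ ^ 2 := by
    by_contra h
    nlinarith
  have h4 := Real.sq_sqrt hρ0.le
  have h5 : 1 < (√ρ * ‖zPlus ρ θ‖) ^ 2 := by rw [mul_pow, h4]; exact h3
  exact (one_lt_sq_iff₀ (by positivity)).1 h5

lemma norm_zMinus_lt_one {ρ : ℝ} (hρ0 : 0 < ρ) {θ : ℂ} (hw : 2 * √ρ < (1 + ρ + θ).re) :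
    √ρ * ‖zMinus ρ θ‖ < 1 := by
  have h1 := one_lt_norm_zPlus hρ0 hw
  have h2 := congrArg norm (zPlus_mul_zMinus hρ0 θ)
  rw [norm_mul, norm_mul, Complex.norm_real, Real.norm_of_nonneg hρ0.le, norm_one] at h2
  have h4 := Real.mul_self_sqrt hρ0.le
  have h5 : (√ρ * ‖zPlus ρ θ‖) * (√ρ * ‖zMinus ρ θ‖) = 1 := by
    linear_combination h2 + ‖zPlus ρ θ‖ * ‖zMinus ρ θ‖ * h4
  by_contra h
  nlinarith

lemma norm_zMinus_lt {ρ : ℝ} (hρ0 : 0 < ρ) {θ : ℂ} (hw : 2 * √ρ < (1 + ρ + θ).re) :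
    ‖zMinus ρ θ‖ < ‖zPlus ρ θ‖ :=
  lt_of_mul_lt_mul_left ((norm_zMinus_lt_one hρ0 hw).trans (one_lt_norm_zPlus hρ0 hw))
    (Real.sqrt_nonneg ρ)

lemma zPlus_ne_zero {ρ : ℝ} (hρ0 : 0 < ρ) (θ : ℂ) : zPlus ρ θ ≠ 0 :=
  Complex.normSq_pos.1 (normSq_zPlus_pos hρ0 θ)

lemma zMinus_ne_zero {ρ : ℝ} (hρ0 : 0 < ρ) (θ : ℂ) : zMinus ρ θ ≠ 0 := by
  intro h
  have := zPlus_mul_zMinus hρ0 θ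
  simp [h] at this

lemma zPlus_sub_zMinus_ne_zero {ρ : ℝ} (hρ0 : 0 < ρ) {θ : ℂ} (hw : 2 * √ρ < (1 + ρ + θ).re) :
    zPlus ρ θ - zMinus ρ θ ≠ 0 := by
  intro h
  have h2 := re_zMinus_lt hρ0 hw
  have := congrArg Complex.re h
  simp only [Complex.sub_re, Complex.zero_re] at this
  linarith

lemma alpha_mul {ρ : ℝ} (hρ0 : 0 < ρ) {θ : ℂ} (hw : 2 * √ρ < (1 + ρ + θ).re) :
    alpha ρ θ * (zPlus ρ θ - zMinus ρ θ) = zPlus ρ θ :=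
  div_mul_cancel₀ _ (zPlus_sub_zMinus_ne_zero hρ0 hw)

/-- `α = 1 / (1 - q)` with `q = z₋ / z₊` and `|q| < 1`, and inversion preserves the right
half-plane. This makes the singularity of the integrand of `G` at `z₋` integrable and kills the
boundary term there. -/
lemma re_alpha_pos {ρ : ℝ} (hρ0 : 0 < ρ) {θ : ℂ} (hw : 2 * √ρ < (1 + ρ + θ).re) :
    0 < (alpha ρ θ).re := by
  have hp := zPlus_ne_zero hρ0 θ
  have hd := zPlus_sub_zMinus_ne_zero hρ0 hw
  have hq : ‖zMinus ρ θ / zPlus ρ θ‖ < 1 := by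
    rw [norm_div, div_lt_one (norm_pos_iff.2 hp)]
    exact norm_zMinus_lt hρ0 hw
  have h1 : alpha ρ θ = (1 - zMinus ρ θ / zPlus ρ θ)⁻¹ := by
    unfold alpha
    field_simp
  have hne : (1 - zMinus ρ θ / zPlus ρ θ) ≠ 0 := by
    intro h
    rw [h, inv_zero] at h1
    have := alpha_mul hρ0 hw
    rw [h1, zero_mul] at this
    exact hp this.symm
  rw [h1, Complex.inv_re]
  refine div_pos ?_ (Complex.normSq_pos.2 hne)
  have := (Complex.re_le_norm (zMinus ρ θ / zPlus ρ θ)).trans_lt hq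
  simp only [Complex.sub_re, Complex.one_re]
  linarith

/-- `M` normalizes the weight at `z = 0`. The logarithm of `z₊ / z₋` splits without a multiple of
`2πi` because both roots lie in the right half-plane. -/
lemma M_mul_cpow {ρ : ℝ} (hρ0 : 0 < ρ) {θ : ℂ} (hw : 2 * √ρ < (1 + ρ + θ).re) :
    M ρ θ * (zPlus ρ θ ^ (-alpha ρ θ) * zMinus ρ θ ^ (alpha ρ θ - 1)) = 1 := by
  have hp := zPlus_ne_zero hρ0 θ
  have hm := zMinus_ne_zero hρ0 θ
  have hap := abs_lt.1 (Complex.abs_arg_lt_pi_div_two_iff.2 (Or.inl (re_zPlus_pos hρ0 hw)))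
  have ham := abs_lt.1 (Complex.abs_arg_lt_pi_div_two_iff.2 (Or.inl (re_zMinus_pos hρ0 hw)))
  have hlog : Complex.log (zPlus ρ θ / zMinus ρ θ) =
      Complex.log (zPlus ρ θ) - Complex.log (zMinus ρ θ) := by
    rw [← Complex.log_exp (x := Complex.log (zPlus ρ θ) - Complex.log (zMinus ρ θ)),
      Complex.exp_sub, Complex.exp_log hp, Complex.exp_log hm]
    · rw [Complex.sub_im, Complex.log_im, Complex.log_im]; linarith [hap.1, ham.2]
    · rw [Complex.sub_im, Complex.log_im, Complex.log_im]; linarith [hap.2, ham.1]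
  unfold M
  rw [Complex.cpow_def_of_ne_zero (div_ne_zero hp hm), Complex.cpow_def_of_ne_zero hp,
    Complex.cpow_def_of_ne_zero hm, hlog]
  nth_rewrite 1 [← Complex.exp_log hm]
  rw [← Complex.exp_add, ← Complex.exp_add, ← Complex.exp_add, Complex.exp_eq_one_iff]
  exact ⟨0, by push_cast; ring⟩

lemma zPlus_sub_mem_slitPlane {ρ : ℝ} (hρ0 : 0 < ρ) {θ : ℂ} (hw : 2 * √ρ < (1 + ρ + θ).re)
    {s : ℝ} (hs : s ∈ Icc (0 : ℝ) 1) : zPlus ρ θ - s * zMinus ρ θ ∈ Complex.slitPlane := by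
  left
  rw [Complex.sub_re, Complex.re_ofReal_mul]
  nlinarith [re_zMinus_lt hρ0 hw, re_zMinus_pos hρ0 hw, hs.1, hs.2]

lemma zMinus_sub_mem_slitPlane {ρ : ℝ} (hρ0 : 0 < ρ) {θ : ℂ} (hw : 2 * √ρ < (1 + ρ + θ).re)
    {s : ℝ} (hs : s < 1) : zMinus ρ θ - s * zMinus ρ θ ∈ Complex.slitPlane := by
  left
  rw [Complex.sub_re, Complex.re_ofReal_mul]
  nlinarith [re_zMinus_pos hρ0 hw]

lemma ofReal_mul_cpow {r : ℝ} (hr : 0 < r) {z : ℂ} (hz : z ≠ 0) (c : ℂ) :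
    ((r : ℂ) * z) ^ c = (r : ℂ) ^ c * z ^ c := by
  have hr' : (r : ℂ) ≠ 0 := by exact_mod_cast hr.ne'
  rw [Complex.cpow_def_of_ne_zero (mul_ne_zero hr' hz), Complex.cpow_def_of_ne_zero hr',
    Complex.cpow_def_of_ne_zero hz, Complex.log_ofReal_mul hr hz, ← Complex.exp_add,
    Complex.ofReal_log hr.le]
  congr 1
  ring

/-! ### The functions `G`. -/

/-- On the segment the singular factor is `((1 - s) z₋)^(α-1)`; the positive number `1 - s` comes
out of the principal power, and `(1 - s)^(α-1)` is integrable since `Re α > 0`. -/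
lemma intervalIntegrable_gIntegrand {ρ : ℝ} (hρ0 : 0 < ρ) {θ : ℂ}
    (hw : 2 * √ρ < (1 + ρ + θ).re) (n : ℕ) :
    IntervalIntegrable (fun s : ℝ => gIntegrand ρ θ n (s * zMinus ρ θ) * zMinus ρ θ)
      volume 0 1 := by
  have hα : -1 < (alpha ρ θ - 1).re := by
    simpa using re_alpha_pos hρ0 hw
  have h1 : IntervalIntegrable (fun s : ℝ => ((1 - s : ℝ) : ℂ) ^ (alpha ρ θ - 1)) volume 0 1 := by
    have := (intervalIntegral.intervalIntegrable_cpow' (a := 1) (b := 0) hα).comp_sub_left 1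
    simpa using this
  have h2 : ContinuousOn (fun s : ℝ => ((s : ℂ) * zMinus ρ θ) ^ n *
      (zPlus ρ θ - s * zMinus ρ θ) ^ (-alpha ρ θ) *
      (zMinus ρ θ ^ (alpha ρ θ - 1) * zMinus ρ θ)) (uIcc 0 1) := by
    refine ContinuousOn.mul (ContinuousOn.mul (by fun_prop) ?_) continuousOn_const
    refine ContinuousOn.cpow_const (by fun_prop) fun s hs => ?_
    rw [uIcc_of_le zero_le_one] at hs
    exact zPlus_sub_mem_slitPlane hρ0 hw hs
  refine (h1.continuousOn_mul h2).congr_ae ?_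
  have h3 : ∀ᵐ s : ℝ ∂volume, s ≠ 1 := by simp [ae_iff]
  filter_upwards [ae_restrict_of_ae h3, ae_restrict_mem measurableSet_uIoc] with s hs1 hs
  rw [uIoc_of_le zero_le_one] at hs
  have h4 : zMinus ρ θ - s * zMinus ρ θ = ((1 - s : ℝ) : ℂ) * zMinus ρ θ := by
    push_cast; ring
  rw [gIntegrand, h4, ofReal_mul_cpow (by linarith [lt_of_le_of_ne hs.2 hs1])
    (zMinus_ne_zero hρ0 θ)]
  ring

/-- On the segment `|z^n| ≤ |z₋|^n`, so the `L¹` norm of the integrand for `n = 0` serves as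
constant. -/
lemma exists_norm_G_le {ρ : ℝ} (hρ0 : 0 < ρ) {θ : ℂ} (hw : 2 * √ρ < (1 + ρ + θ).re) :
    ∃ C : ℝ, ∀ n, ‖G ρ θ n‖ ≤ C * ‖zMinus ρ θ‖ ^ n := by
  refine ⟨∫ s in (0 : ℝ)..1, ‖gIntegrand ρ θ 0 (s * zMinus ρ θ) * zMinus ρ θ‖, fun n => ?_⟩
  rw [G, ← intervalIntegral.integral_mul_const]
  refine intervalIntegral.norm_integral_le_of_norm_le zero_le_one (ae_of_all _ fun s hs => ?_)
    ((intervalIntegrable_gIntegrand hρ0 hw 0).norm.mul_const _)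
  have h : gIntegrand ρ θ n (s * zMinus ρ θ) * zMinus ρ θ =
      gIntegrand ρ θ 0 (s * zMinus ρ θ) * zMinus ρ θ * (s * zMinus ρ θ) ^ n := by
    simp only [gIntegrand]; ring
  rw [h, norm_mul, norm_pow, norm_mul (s : ℂ), Complex.norm_real, Real.norm_of_nonneg hs.1.le]
  gcongr
  · exact mul_nonneg hs.1.le (norm_nonneg (zMinus ρ θ))
  · exact mul_le_of_le_one_left (norm_nonneg (zMinus ρ θ)) hs.2

lemma rho_mul_norm_zMinus_lt_one {ρ : ℝ} (hρ0 : 0 < ρ) (hρ1 : ρ < 1) {θ : ℂ}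
    (hw : 2 * √ρ < (1 + ρ + θ).re) : ρ * ‖zMinus ρ θ‖ < 1 := by
  have h1 := norm_zMinus_lt_one hρ0 hw
  have h2 : √ρ < 1 := by rw [Real.sqrt_lt' one_pos]; simpa using hρ1
  have h3 := Real.mul_self_sqrt hρ0.le
  have h4 := Real.sqrt_pos.2 hρ0
  have h5 := mul_lt_mul_of_pos_left h1 h4
  calc ρ * ‖zMinus ρ θ‖ = √ρ * (√ρ * ‖zMinus ρ θ‖) := by rw [← mul_assoc, h3]
    _ < 1 := by linarith

lemma summable_G {ρ : ℝ} (hρ0 : 0 < ρ) (hρ1 : ρ < 1) {θ : ℂ}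
    (hw : 2 * √ρ < (1 + ρ + θ).re) : Summable (fun l : ℕ => (ρ : ℂ) ^ l * G ρ θ l) := by
  obtain ⟨C, hC⟩ := exists_norm_G_le hρ0 hw
  refine Summable.of_norm_bounded
    ((summable_geometric_of_lt_one (by positivity)
      (rho_mul_norm_zMinus_lt_one hρ0 hρ1 hw)).mul_left C) fun l => ?_
  rw [norm_mul, norm_pow, Complex.norm_real, Real.norm_of_nonneg hρ0.le, mul_pow]
  calc ρ ^ l * ‖G ρ θ l‖ ≤ ρ ^ l * (C * ‖zMinus ρ θ‖ ^ l) := by gcongr; exact hC l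
    _ = _ := by ring

/-- An antiderivative of the combination of `gIntegrand` that appears in the recurrence. -/
lemma hasDerivAt_gPrimitive {ρ : ℝ} (hρ0 : 0 < ρ) {θ : ℂ} (hw : 2 * √ρ < (1 + ρ + θ).re) (n : ℕ)
    {z : ℂ} (hp : zPlus ρ θ - z ∈ Complex.slitPlane) (hm : zMinus ρ θ - z ∈ Complex.slitPlane) :
    HasDerivAt (fun z => ρ * (z ^ n * (zPlus ρ θ - z) ^ (1 - alpha ρ θ) *
        (zMinus ρ θ - z) ^ alpha ρ θ))
      (((n : ℂ) + 1) * ρ * gIntegrand ρ θ (n + 1) z -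
        ((n : ℂ) + 1) * (1 + ρ + θ) * gIntegrand ρ θ n z + n * gIntegrand ρ θ (n - 1) z) z := by
  have hp0 := Complex.slitPlane_ne_zero hp
  have hm0 := Complex.slitPlane_ne_zero hm
  have h1 := ((hasDerivAt_id z).const_sub (zPlus ρ θ)).cpow_const (c := 1 - alpha ρ θ) hp
  have h2 := ((hasDerivAt_id z).const_sub (zMinus ρ θ)).cpow_const (c := alpha ρ θ) hm
  have h3 := (((hasDerivAt_pow n z).mul h1).mul h2).const_mul (ρ : ℂ)
  refine h3.congr_deriv ?_
  have e1 : (zPlus ρ θ - z) ^ (1 - alpha ρ θ) =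
      (zPlus ρ θ - z) * (zPlus ρ θ - z) ^ (-alpha ρ θ) := by
    rw [sub_eq_add_neg 1, Complex.cpow_add _ _ hp0, Complex.cpow_one]
  have e2 : (zMinus ρ θ - z) ^ alpha ρ θ =
      (zMinus ρ θ - z) * (zMinus ρ θ - z) ^ (alpha ρ θ - 1) := by
    rw [Complex.cpow_sub _ _ hm0, Complex.cpow_one]
    field_simp
  have e3 : (1 - alpha ρ θ - 1) = -alpha ρ θ := by ring
  simp only [id, e3, e1, e2, gIntegrand, Pi.mul_apply]
  have k1 := zPlus_add_zMinus hρ0 θ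
  have k2 := zPlus_mul_zMinus hρ0 θ
  -- The choice of `α` enters here: it gives the weight `(z₊ - z)^(-α) (z₋ - z)^(α-1)` the
  -- logarithmic derivative `-z / ((z₊ - z)(z₋ - z))`.
  have k3 := alpha_mul hρ0 hw
  set a := zPlus ρ θ
  set b := zMinus ρ θ
  set u := (a - z) ^ (-alpha ρ θ)
  set v := (b - z) ^ (alpha ρ θ - 1)
  rw [← k1]
  rcases n with _ | n
  · simp only [Nat.cast_zero, pow_zero]
    linear_combination (-ρ * u * v) * k3
  · simp only [Nat.add_sub_cancel, pow_succ]
    push_cast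
    linear_combination (-ρ * u * v * z ^ n * z) * k3 + (n + 1) * z ^ n * u * v * k2

/-- Integrate the primitive of `hasDerivAt_gPrimitive` over the segment. It vanishes at `z₋` because
`Re α > 0`; at `0` it contains the factor `0 ^ n`, so only `n = 0` leaves a defect. -/
lemma G_combination {ρ : ℝ} (hρ0 : 0 < ρ) {θ : ℂ} (hw : 2 * √ρ < (1 + ρ + θ).re) (n : ℕ) :
    ((n : ℂ) + 1) * ρ * G ρ θ (n + 1) - ((n : ℂ) + 1) * (1 + ρ + θ) * G ρ θ n
      + n * G ρ θ (n - 1) =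
    -(ρ * (0 ^ n * zPlus ρ θ ^ (1 - alpha ρ θ) * zMinus ρ θ ^ alpha ρ θ)) := by
  have hi := intervalIntegrable_gIntegrand hρ0 hw
  have hα := re_alpha_pos hρ0 hw
  have hα0 : alpha ρ θ ≠ 0 := by intro h; simp [h] at hα
  have key := intervalIntegral.integral_eq_sub_of_hasDerivAt_of_le (a := 0) (b := 1)
    (f := fun s : ℝ => (ρ : ℂ) * (((s : ℂ) * zMinus ρ θ) ^ n *
      (zPlus ρ θ - s * zMinus ρ θ) ^ (1 - alpha ρ θ) *
        (zMinus ρ θ - s * zMinus ρ θ) ^ alpha ρ θ))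
    (f' := fun s : ℝ => ((n : ℂ) + 1) * ρ * (gIntegrand ρ θ (n + 1) (s * zMinus ρ θ) * zMinus ρ θ)
      - ((n : ℂ) + 1) * (1 + ρ + θ) * (gIntegrand ρ θ n (s * zMinus ρ θ) * zMinus ρ θ)
      + n * (gIntegrand ρ θ (n - 1) (s * zMinus ρ θ) * zMinus ρ θ)) zero_le_one ?_ ?_ ?_
  · rw [intervalIntegral.integral_add (((hi _).const_mul _).sub ((hi _).const_mul _))
      ((hi _).const_mul _), intervalIntegral.integral_sub ((hi _).const_mul _)
      ((hi _).const_mul _), intervalIntegral.integral_const_mul,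
      intervalIntegral.integral_const_mul, intervalIntegral.integral_const_mul] at key
    unfold G
    rw [key]
    simp [Complex.zero_cpow hα0]
  · refine ContinuousOn.mul continuousOn_const (ContinuousOn.mul (ContinuousOn.mul
      (by fun_prop) ?_) ?_)
    · exact ContinuousOn.cpow_const (by fun_prop) fun s hs => zPlus_sub_mem_slitPlane hρ0 hw hs
    · intro s hs
      refine ContinuousAt.continuousWithinAt ?_
      refine ContinuousAt.comp (g := fun z : ℂ => z ^ alpha ρ θ)
        (f := fun s : ℝ => zMinus ρ θ - s * zMinus ρ θ) ?_ (by fun_prop)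
      refine Complex.continuousAt_cpow_const_of_re_pos (Or.inl ?_) hα
      rw [Complex.sub_re, Complex.re_ofReal_mul]
      nlinarith [re_zMinus_pos hρ0 hw, hs.2]
  · intro s hs
    have h1 := hasDerivAt_gPrimitive hρ0 hw n
      (zPlus_sub_mem_slitPlane hρ0 hw (Ioo_subset_Icc_self hs))
      (zMinus_sub_mem_slitPlane hρ0 hw hs.2)
    have h2 : HasDerivAt (fun t : ℝ => (t : ℂ) * zMinus ρ θ) (zMinus ρ θ) s := by
      simpa using (Complex.ofRealCLM.hasDerivAt (x := s)).mul_const (zMinus ρ θ)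
    refine (h1.comp s h2).congr_deriv ?_
    ring
  · exact (((hi _).const_mul _).sub ((hi _).const_mul _)).add ((hi _).const_mul _)

lemma G_recurrence {ρ : ℝ} (hρ0 : 0 < ρ) {θ : ℂ} (hw : 2 * √ρ < (1 + ρ + θ).re) (n : ℕ)
    (hn : n ≠ 0) :
    ((n : ℂ) + 1) * ρ * G ρ θ (n + 1) - ((n : ℂ) + 1) * (1 + ρ + θ) * G ρ θ n
      + n * G ρ θ (n - 1) = 0 := by
  rw [G_combination hρ0 hw, zero_pow hn]
  ring

/-- The defect at `n = 0` is `-ρ z₊ z₋` times the weight at the origin, that is `-1 / M`. -/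
lemma M_mul_G_recurrence_zero {ρ : ℝ} (hρ0 : 0 < ρ) {θ : ℂ} (hw : 2 * √ρ < (1 + ρ + θ).re) :
    ρ * (M ρ θ * G ρ θ 1) - (1 + ρ + θ) * (M ρ θ * G ρ θ 0) = -1 := by
  have h := G_combination hρ0 hw 0
  have h1 := M_mul_cpow hρ0 hw
  have e1 : zPlus ρ θ ^ (1 - alpha ρ θ) = zPlus ρ θ * zPlus ρ θ ^ (-alpha ρ θ) := by
    rw [sub_eq_add_neg 1, Complex.cpow_add _ _ (zPlus_ne_zero hρ0 θ), Complex.cpow_one]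
  have e2 : zMinus ρ θ ^ alpha ρ θ = zMinus ρ θ * zMinus ρ θ ^ (alpha ρ θ - 1) := by
    have := zMinus_ne_zero hρ0 θ
    rw [Complex.cpow_sub _ _ this, Complex.cpow_one]
    field_simp
  rw [e1, e2] at h
  simp only [Nat.cast_zero, zero_add, one_mul, pow_zero, zero_mul, add_zero] at h
  have k2 := zPlus_mul_zMinus hρ0 θ
  linear_combination M ρ θ * h - (M ρ θ * zPlus ρ θ ^ (-alpha ρ θ) *
    zMinus ρ θ ^ (alpha ρ θ - 1)) * k2 - h1

/-! ### Contour integrals -/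

/-- Differentiability on `Icc 0 1` controls only one-sided derivatives at the endpoints, so `deriv
γ` is replaced by the continuous `derivWithin` off a null set. -/
lemma derivWithin_ae_eq_deriv_Icc (γ : ℝ → ℂ) :
    ∀ᵐ t ∂volume.restrict (uIoc (0 : ℝ) 1), derivWithin γ (Icc 0 1) t = deriv γ t := by
  have h3 : ∀ᵐ s : ℝ ∂volume, s ≠ 1 := by simp [ae_iff]
  filter_upwards [ae_restrict_of_ae h3, ae_restrict_mem measurableSet_uIoc] with s hs1 hs
  rw [uIoc_of_le zero_le_one] at hs
  exact derivWithin_of_mem_nhds (Icc_mem_nhds hs.1 (lt_of_le_of_ne hs.2 hs1))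

lemma intervalIntegrable_contour {γ : ℝ → ℂ} (hγ : ContDiffOn ℝ 1 γ (Icc 0 1)) {f : ℂ → ℂ}
    (hf : ContinuousOn (fun t => f (γ t)) (Icc 0 1)) :
    IntervalIntegrable (fun t => f (γ t) * deriv γ t) volume 0 1 := by
  have h1 : ContinuousOn (fun t => f (γ t) * derivWithin γ (Icc 0 1) t) (Icc 0 1) :=
    hf.mul (hγ.continuousOn_derivWithin (uniqueDiffOn_Icc zero_lt_one) le_rfl)
  refine (h1.intervalIntegrable_of_Icc zero_le_one).congr_ae ?_
  filter_upwards [derivWithin_ae_eq_deriv_Icc γ] with t ht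
  rw [ht]

/-- A function with a primitive near a closed contour has vanishing integral. -/
lemma contourIntegral_eq_zero {γ : ℝ → ℂ} (hγ : ContDiffOn ℝ 1 γ (Icc 0 1)) (hc : γ 0 = γ 1)
    {f F : ℂ → ℂ} (hf : ContinuousOn (fun t => f (γ t)) (Icc 0 1))
    (hF : ∀ t ∈ Icc (0 : ℝ) 1, HasDerivAt F (f (γ t)) (γ t)) : contourIntegral γ f = 0 := by
  have key := intervalIntegral.integral_eq_sub_of_hasDerivAt_of_le (a := 0) (b := 1)
    (f := fun t => F (γ t)) (f' := fun t => f (γ t) * deriv γ t) zero_le_one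
    (fun t ht => (hF t ht).continuousAt.comp_continuousWithinAt (hγ.continuousOn t ht))
    (fun t ht => (hF t (Ioo_subset_Icc_self ht)).comp t
      ((hγ.differentiableOn one_ne_zero).differentiableAt (Icc_mem_nhds ht.1 ht.2)).hasDerivAt)
    (intervalIntegrable_contour hγ hf)
  rw [contourIntegral, key, hc, sub_self]

/-! ### The Möbius map `(z - a) / (z - b)` and its logarithm -/

lemma ne_right_of_notMem_segment {a b z : ℂ} (hz : z ∉ segment ℝ b a) : z - b ≠ 0 := by
  intro h
  exact hz (sub_eq_zero.1 h ▸ left_mem_segment ℝ b a)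

lemma ne_left_of_notMem_segment {a b z : ℂ} (hz : z ∉ segment ℝ b a) : z - a ≠ 0 := by
  intro h
  exact hz (sub_eq_zero.1 h ▸ right_mem_segment ℝ b a)

/-- If the quotient equals `-t` with `t ≥ 0`, then `z = (a + t b) / (1 + t)` lies on the segment. -/
lemma div_mem_slitPlane {a b z : ℂ} (hz : z ∉ segment ℝ b a) :
    (z - a) / (z - b) ∈ Complex.slitPlane := by
  have hb := ne_right_of_notMem_segment hz
  by_contra h
  rw [Complex.mem_slitPlane_iff_not_le_zero, not_not, Complex.nonpos_iff] at h
  set t := -((z - a) / (z - b)).re with ht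
  have ht0 : 0 ≤ t := by linarith [h.1]
  have he : (z - a) / (z - b) = ((-t : ℝ) : ℂ) := by
    apply Complex.ext
    · simp [ht]
    · simpa using h.2
  rw [div_eq_iff hb] at he
  refine hz ⟨t / (1 + t), 1 / (1 + t), by positivity, by positivity, by field_simp; ring, ?_⟩
  have h1 : (1 + t : ℂ) ≠ 0 := by
    have : (1 + t : ℝ) ≠ 0 := by positivity
    exact_mod_cast this
  simp only [Complex.real_smul]
  push_cast at he ⊢
  field_simp
  linear_combination -he

lemma hasDerivAt_mobius {a b z : ℂ} (hb : z - b ≠ 0) :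
    HasDerivAt (fun z => (z - a) / (z - b)) ((a - b) / (z - b) ^ 2) z := by
  refine (((hasDerivAt_id z).sub_const a).div ((hasDerivAt_id z).sub_const b) hb).congr_deriv ?_
  simp only [id]
  congr 1
  ring

/-- On the strip `|Im v| < π` the function `(exp (-α v) - 1) exp v / (1 - exp v)` has a primitive. -/
lemma exists_primitive_strip (α : ℂ) : ∃ K : ℂ → ℂ, ∀ v : ℂ, |v.im| < Real.pi → v ≠ 0 →
    HasDerivAt K ((Complex.exp (-α * v) - 1) * Complex.exp v / (1 - Complex.exp v)) v := by
  have hopen : IsOpen {v : ℂ | |v.im| < Real.pi} :=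
    isOpen_lt (by fun_prop) continuous_const
  have hconv : Convex ℝ {v : ℂ | |v.im| < Real.pi} := by
    have : {v : ℂ | |v.im| < Real.pi} = Complex.imLm ⁻¹' (Ioo (-Real.pi) Real.pi) := by
      ext v; simp [abs_lt]
    rw [this]
    exact (convex_Ioo _ _).linear_preimage _
  -- On the strip `log` inverts `exp`, so `0` is the only zero of `exp v - 1`.
  have hexp : ∀ v : ℂ, |v.im| < Real.pi → v ≠ 0 → Complex.exp v ≠ 1 := by
    intro v hv h0 h1
    apply h0
    have h2 := Complex.log_exp (abs_lt.1 hv).1 (abs_lt.1 hv).2.le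
    rw [← h2, h1, Complex.log_one]
  have h0mem : {v : ℂ | |v.im| < Real.pi} ∈ nhds (0 : ℂ) :=
    hopen.mem_nhds (by simp [Real.pi_pos])
  -- Numerator and denominator both vanish at `0`, the denominator simply. Dividing each by `v`, in
  -- the form of `dslope`, removes the singularity; a holomorphic function on the convex strip has a
  -- primitive.
  have hd1 : DifferentiableOn ℂ (dslope (fun v => Complex.exp (-α * v)) 0)
      {v : ℂ | |v.im| < Real.pi} :=
    (Complex.differentiableOn_dslope h0mem).2 (by fun_prop)
  have hd2 : DifferentiableOn ℂ (dslope Complex.exp 0) {v : ℂ | |v.im| < Real.pi} :=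
    (Complex.differentiableOn_dslope h0mem).2 (by fun_prop)
  have hne : ∀ v ∈ {v : ℂ | |v.im| < Real.pi}, dslope Complex.exp 0 v ≠ 0 := by
    intro v hv
    by_cases h0 : v = 0
    · simp [h0]
    · rw [dslope_of_ne _ h0, slope_def_field]
      exact div_ne_zero (sub_ne_zero.2 (by simpa using hexp v hv h0)) (by simpa using h0)
  obtain ⟨K, hK⟩ := hconv.exists_forall_hasDerivWithinAt
    (((hd1.mul (by fun_prop : DifferentiableOn ℂ Complex.exp _)).div hd2 hne).neg)
  refine ⟨K, fun v hv h0 => ((hK v hv).hasDerivAt (hopen.mem_nhds hv)).congr_deriv ?_⟩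
  have h1 := sub_ne_zero.2 (hexp v hv h0)
  have h1' := sub_ne_zero.2 (hexp v hv h0).symm
  simp only [Pi.neg_apply, Pi.div_apply, Pi.mul_apply, dslope_of_ne _ h0, slope_def_field]
  simp only [sub_zero, mul_zero, Complex.exp_zero]
  field_simp
  ring

/-- The integral of `(z - b)⁻¹ ((z - a) / (z - b)) ^ (-α)` around `[b, a]` does not depend
on `α`. -/
lemma contourIntegral_mobius_cpow {γ : ℝ → ℂ} {a b : ℂ} (hab : a - b ≠ 0)
    (hγ : IsContourAround γ b a) (α : ℂ) :
    contourIntegral γ (fun z => (z - b)⁻¹ * ((z - a) / (z - b)) ^ (-α)) =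
      2 * Real.pi * Complex.I := by
  obtain ⟨K, hK⟩ := exists_primitive_strip α
  have hcγ := hγ.contDiffOn.continuousOn
  have hc1 : ContinuousOn (fun t => (γ t - b)⁻¹) (Icc 0 1) :=
    (hcγ.sub continuousOn_const).inv₀ fun t ht => ne_right_of_notMem_segment (hγ.avoids t ht)
  have hc2 : ContinuousOn (fun t => ((γ t - a) / (γ t - b)) ^ (-α)) (Icc 0 1) :=
    ContinuousOn.cpow_const ((hcγ.sub continuousOn_const).div (hcγ.sub continuousOn_const)
      fun t ht => ne_right_of_notMem_segment (hγ.avoids t ht))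
      fun t ht => div_mem_slitPlane (hγ.avoids t ht)
  -- Subtract the integrand for `α = 0`, whose integral is the winding number. With `v = log ((z -
  -- a) / (z - b))` one has `exp v / (1 - exp v) dv = dz / (z - b)`, so the difference has the
  -- primitive `K` composed with `v`.
  have hzero := contourIntegral_eq_zero hγ.contDiffOn hγ.closed
    (f := fun z => (z - b)⁻¹ * ((z - a) / (z - b)) ^ (-α) - (z - b)⁻¹)
    (F := fun z => K (Complex.log ((z - a) / (z - b)))) ((hc1.mul hc2).sub hc1) ?_
  · have i1 := intervalIntegrable_contour hγ.contDiffOn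
      (f := fun z => (z - b)⁻¹ * ((z - a) / (z - b)) ^ (-α)) (hc1.mul hc2)
    have i2 := intervalIntegrable_contour hγ.contDiffOn (f := fun z => (z - b)⁻¹) hc1
    rw [← hγ.winding, ← sub_eq_zero, ← hzero]
    simp only [contourIntegral]
    rw [← intervalIntegral.integral_sub i1 i2]
    simp only [sub_mul]
  · intro t ht
    have hz := hγ.avoids t ht
    set z := γ t
    have hb := ne_right_of_notMem_segment hz
    have ha := ne_left_of_notMem_segment hz
    have hs := div_mem_slitPlane hz
    have hs0 := Complex.slitPlane_ne_zero hs
    have him : |(Complex.log ((z - a) / (z - b))).im| < Real.pi := by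
      rw [Complex.log_im, abs_lt]
      exact ⟨Complex.neg_pi_lt_arg _, lt_of_le_of_ne (Complex.arg_le_pi _)
        (Complex.slitPlane_arg_ne_pi hs)⟩
    -- The value `v = 0` corresponds to `z = ∞`.
    have hl0 : Complex.log ((z - a) / (z - b)) ≠ 0 := by
      intro h
      have h1 := Complex.exp_log hs0
      rw [h, Complex.exp_zero, eq_comm, div_eq_one_iff_eq hb] at h1
      exact hab (by linear_combination -h1)
    refine ((hK _ him hl0).comp z ((hasDerivAt_mobius hb).clog hs)).congr_deriv ?_
    have hcp : Complex.exp (-α * Complex.log ((z - a) / (z - b))) =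
        ((z - a) / (z - b)) ^ (-α) := by
      rw [Complex.cpow_def_of_ne_zero hs0, mul_comm]
    rw [hcp, Complex.exp_log hs0]
    have e1 : 1 - (z - a) / (z - b) = (a - b) / (z - b) := by
      field_simp
      ring
    rw [e1]
    field_simp

/-! ### The functions `H` -/

lemma hasDerivAt_branch {ρ : ℝ} (hρ0 : 0 < ρ) {θ : ℂ} (hw : 2 * √ρ < (1 + ρ + θ).re) {z : ℂ}
    (hz : z ∉ segment ℝ (zMinus ρ θ) (zPlus ρ θ)) :
    HasDerivAt (branch ρ θ)
      (-(z / ((z - zPlus ρ θ) * (z - zMinus ρ θ))) * branch ρ θ z) z := by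
  have hb := ne_right_of_notMem_segment hz
  have ha := ne_left_of_notMem_segment hz
  have hs := div_mem_slitPlane hz
  have hs0 := Complex.slitPlane_ne_zero hs
  have h1 := ((hasDerivAt_id z).sub_const (zMinus ρ θ)).inv hb
  have h2 := (hasDerivAt_mobius (a := zPlus ρ θ) hb).cpow_const (c := -alpha ρ θ) hs
  refine ((h1.mul h2).const_mul
    (Complex.exp (-(Complex.I * alpha ρ θ * Real.pi)))).congr_deriv ?_
  have k3 := alpha_mul hρ0 hw
  rw [branch, Complex.cpow_sub _ _ hs0, Complex.cpow_one]
  simp only [id, Pi.inv_apply]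
  set a := zPlus ρ θ
  set b := zMinus ρ θ
  set u := ((z - a) / (z - b)) ^ (-alpha ρ θ)
  field_simp
  linear_combination -u * k3

lemma continuousOn_branch {ρ : ℝ} (hρ0 : 0 < ρ) {θ : ℂ} (hw : 2 * √ρ < (1 + ρ + θ).re)
    {γ : ℝ → ℂ} (hγ : IsContourAround γ (zMinus ρ θ) (zPlus ρ θ)) (n : ℕ) :
    ContinuousOn (fun t => γ t ^ n * branch ρ θ (γ t)) (Icc 0 1) := by
  have hcγ := hγ.contDiffOn.continuousOn
  refine (hcγ.pow n).mul fun t ht => ?_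
  exact (hasDerivAt_branch hρ0 hw (hγ.avoids t ht)).continuousAt.comp_continuousWithinAt (hcγ t ht)

lemma H_zero {ρ : ℝ} (hρ0 : 0 < ρ) {θ : ℂ} (hw : 2 * √ρ < (1 + ρ + θ).re)
    {γ : ℝ → ℂ} (hγ : IsContourAround γ (zMinus ρ θ) (zPlus ρ θ)) : H ρ θ γ 0 = 1 := by
  have h := contourIntegral_mobius_cpow (zPlus_sub_zMinus_ne_zero hρ0 hw) hγ (alpha ρ θ)
  have hpi : (2 * Real.pi * Complex.I : ℂ) ≠ 0 := Complex.two_pi_I_ne_zero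
  have h2 : contourIntegral γ (fun z => z ^ 0 * branch ρ θ z) =
      Complex.exp (-(Complex.I * alpha ρ θ * Real.pi)) * (2 * Real.pi * Complex.I) := by
    rw [← h]
    simp only [contourIntegral, branch, pow_zero, one_mul]
    rw [← intervalIntegral.integral_const_mul]
    simp only [mul_assoc]
  rw [H, h2, Complex.exp_neg]
  have := Complex.exp_ne_zero (Complex.I * alpha ρ θ * Real.pi)
  field_simp

/-- `branch` has the same logarithmic derivative as the weight of `G`, so the same combination has a
primitive. On a closed contour there are no boundary terms, hence no defect at `n = 0`. -/
lemma H_recurrence {ρ : ℝ} (hρ0 : 0 < ρ) {θ : ℂ} (hw : 2 * √ρ < (1 + ρ + θ).re)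
    {γ : ℝ → ℂ} (hγ : IsContourAround γ (zMinus ρ θ) (zPlus ρ θ)) (n : ℕ) :
    ((n : ℂ) + 1) * ρ * H ρ θ γ (n + 1) - ((n : ℂ) + 1) * (1 + ρ + θ) * H ρ θ γ n
      + n * H ρ θ γ (n - 1) = 0 := by
  have hc := continuousOn_branch hρ0 hw hγ
  have hi := fun m => intervalIntegrable_contour hγ.contDiffOn
    (f := fun z => z ^ m * branch ρ θ z) (hc m)
  have hzero := contourIntegral_eq_zero hγ.contDiffOn hγ.closed
    (f := fun z => ((n : ℂ) + 1) * ρ * (z ^ (n + 1) * branch ρ θ z) -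
      ((n : ℂ) + 1) * (1 + ρ + θ) * (z ^ n * branch ρ θ z) + n * (z ^ (n - 1) * branch ρ θ z))
    (F := fun z => z ^ n * (ρ * z ^ 2 - (1 + ρ + θ) * z + 1) * branch ρ θ z)
    (((continuousOn_const.mul (hc _)).sub (continuousOn_const.mul (hc _))).add
      (continuousOn_const.mul (hc _))) ?_
  · have hlin : contourIntegral γ (fun z => ((n : ℂ) + 1) * ρ * (z ^ (n + 1) * branch ρ θ z) -
        ((n : ℂ) + 1) * (1 + ρ + θ) * (z ^ n * branch ρ θ z) +
        n * (z ^ (n - 1) * branch ρ θ z)) =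
        ((n : ℂ) + 1) * ρ * contourIntegral γ (fun z => z ^ (n + 1) * branch ρ θ z) -
        ((n : ℂ) + 1) * (1 + ρ + θ) * contourIntegral γ (fun z => z ^ n * branch ρ θ z) +
        n * contourIntegral γ (fun z => z ^ (n - 1) * branch ρ θ z) := by
      simp only [contourIntegral]
      rw [← intervalIntegral.integral_const_mul, ← intervalIntegral.integral_const_mul,
        ← intervalIntegral.integral_const_mul, ← intervalIntegral.integral_sub
        ((hi _).const_mul _) ((hi _).const_mul _), ← intervalIntegral.integral_add
        (((hi _).const_mul _).sub ((hi _).const_mul _)) ((hi _).const_mul _)]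
      congr 1
      ext t
      ring
    rw [hlin] at hzero
    simp only [H]
    linear_combination Complex.exp (Complex.I * alpha ρ θ * Real.pi) /
      (2 * Real.pi * Complex.I) * hzero
  · intro t ht
    have hz := hγ.avoids t ht
    set z := γ t
    have hb := ne_right_of_notMem_segment hz
    have ha := ne_left_of_notMem_segment hz
    have h1 : HasDerivAt (fun z : ℂ => ρ * z ^ 2 - (1 + ρ + θ) * z + 1)
        (ρ * (2 * z) - (1 + ρ + θ)) z := by
      refine ((((hasDerivAt_pow 2 z).const_mul (ρ : ℂ)).sub
        ((hasDerivAt_id z).const_mul (1 + ρ + θ))).add_const 1).congr_deriv ?_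
      simp
    refine (((hasDerivAt_pow n z).mul h1).mul (hasDerivAt_branch hρ0 hw hz)).congr_deriv ?_
    have k1 := zPlus_add_zMinus hρ0 θ
    have k2 := zPlus_mul_zMinus hρ0 θ
    simp only [Pi.mul_apply]
    set a := zPlus ρ θ
    set b := zMinus ρ θ
    set u := branch ρ θ z
    have e : ρ * z ^ 2 - (1 + ρ + θ) * z + 1 = ρ * ((z - a) * (z - b)) := by
      linear_combination z * k1 - k2
    have e2 : (ρ * z ^ 2 - (1 + ρ + θ) * z + 1) * -(z / ((z - a) * (z - b))) = -(ρ * z) := by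
      rw [e]; field_simp
    rcases n with _ | n
    · simp only [Nat.cast_zero, pow_zero]
      linear_combination u * e2
    · simp only [Nat.add_sub_cancel, pow_succ]
      push_cast
      linear_combination z ^ n * z * u * e2

/-! ### The difference equation -/

/-- The homogeneous equation has no nonzero solution of size `O(ρ ^ (-n/2))`. -/
lemma eq_zero_of_homogeneous {ρ : ℝ} (hρ0 : 0 < ρ) {w : ℂ} (hw : 2 * √ρ < ‖w‖) {d : ℕ → ℂ}
    (hd : ∀ n : ℕ, ((n : ℂ) + 1) * ρ * d (n + 1) - ((n : ℂ) + 1) * w * d n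
      + n * d (n - 1) = 0) {C : ℝ} (hC : ∀ n, ‖d n‖ * √ρ ^ n ≤ C) (n : ℕ) : d n = 0 := by
  have hs0 := Real.sqrt_pos.2 hρ0
  have hss := Real.mul_self_sqrt hρ0.le
  have hw0 : 0 < ‖w‖ := by linarith
  -- A uniform bound `B` on `‖d n‖ * √ρ ^ n` reproduces itself through the recurrence with the extra
  -- factor `2√ρ / ‖w‖ < 1`; iterating forces `d = 0`.
  have key : ∀ k n, ‖d n‖ * √ρ ^ n ≤ C * (2 * √ρ / ‖w‖) ^ k := by
    intro k
    induction k with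
    | zero => simpa using hC
    | succ k ih =>
      intro n
      set B := C * (2 * √ρ / ‖w‖) ^ k
      have hB : 0 ≤ B := le_trans (by positivity) (ih 0)
      have h1 : ((n : ℂ) + 1) * w * d n = ((n : ℂ) + 1) * ρ * d (n + 1) + n * d (n - 1) := by
        linear_combination -hd n
      have hn1 : ‖(n : ℂ) + 1‖ = n + 1 := by
        rw [← Nat.cast_add_one, Complex.norm_natCast]; push_cast; rfl
      have h2 : (n + 1) * ‖w‖ * ‖d n‖ ≤ (n + 1) * ρ * ‖d (n + 1)‖ + n * ‖d (n - 1)‖ := by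
        have := (congrArg norm h1).le.trans (norm_add_le _ _)
        simpa [hn1, abs_of_pos hρ0] using this
      have h3 : n * ‖d (n - 1)‖ * √ρ ^ n ≤ n * (√ρ * B) := by
        rcases n with _ | n
        · simp
        · have := mul_le_mul_of_nonneg_left (ih n) hs0.le
          simp only [Nat.add_sub_cancel, pow_succ]
          rw [mul_assoc]
          refine mul_le_mul_of_nonneg_left ?_ (by positivity)
          linarith
      have h4 : ρ * ‖d (n + 1)‖ * √ρ ^ n ≤ √ρ * B := by
        have := mul_le_mul_of_nonneg_left (ih (n + 1)) hs0.le
        calc ρ * ‖d (n + 1)‖ * √ρ ^ n = √ρ * (‖d (n + 1)‖ * √ρ ^ (n + 1)) := by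
              rw [pow_succ]; nth_rewrite 1 [← hss]; ring
          _ ≤ _ := this
      have h5 : (n + 1) * (‖w‖ * (‖d n‖ * √ρ ^ n)) ≤ (n + 1) * (2 * √ρ * B) := by
        calc (n + 1) * (‖w‖ * (‖d n‖ * √ρ ^ n)) = (n + 1) * ‖w‖ * ‖d n‖ * √ρ ^ n := by ring
          _ ≤ ((n + 1) * ρ * ‖d (n + 1)‖ + n * ‖d (n - 1)‖) * √ρ ^ n := by gcongr
          _ = (n + 1) * (ρ * ‖d (n + 1)‖ * √ρ ^ n) + n * ‖d (n - 1)‖ * √ρ ^ n := by ring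
          _ ≤ (n + 1) * (√ρ * B) + n * (√ρ * B) := by gcongr
          _ ≤ (n + 1) * (2 * √ρ * B) := by nlinarith [mul_nonneg hs0.le hB]
      have h6 := le_of_mul_le_mul_left h5 (by positivity)
      calc ‖d n‖ * √ρ ^ n ≤ 2 * √ρ * B / ‖w‖ := by
            rw [le_div_iff₀ hw0]; linarith
        _ = C * (2 * √ρ / ‖w‖) ^ (k + 1) := by simp only [B, pow_succ]; ring
  have hlim : Filter.Tendsto (fun k : ℕ => C * (2 * √ρ / ‖w‖) ^ k) Filter.atTop (nhds 0) := by
    simpa using (tendsto_pow_atTop_nhds_zero_of_lt_one (by positivity)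
      ((div_lt_one hw0).2 hw)).const_mul C
  have h7 : ‖d n‖ * √ρ ^ n ≤ 0 := ge_of_tendsto' hlim fun k => key k n
  have h8 : ‖d n‖ ≤ 0 := le_of_mul_le_mul_right (by simpa using h7) (pow_pos hs0 n)
  exact norm_le_zero_iff.1 h8

lemma recurrence_unique {ρ : ℝ} (hρ0 : 0 < ρ) {θ : ℂ} (hw : 2 * √ρ < (1 + ρ + θ).re)
    {p q : ℕ → ℂ} (hp : SolvesRecurrence ρ θ p) (hq : SolvesRecurrence ρ θ q)
    (hpC : ∃ C : ℝ, ∀ n, ‖p n‖ * √ρ ^ n ≤ C) (hqC : ∃ C : ℝ, ∀ n, ‖q n‖ * √ρ ^ n ≤ C)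
    (n : ℕ) : q n = p n := by
  obtain ⟨C, hC⟩ := hpC
  obtain ⟨D, hD⟩ := hqC
  refine sub_eq_zero.1 (eq_zero_of_homogeneous hρ0 (hw.trans_le (Complex.re_le_norm _))
    (d := fun n => q n - p n) (C := D + C) (fun n => ?_) (fun n => ?_) n)
  · linear_combination hq n - hp n
  · refine le_trans ?_ (add_le_add (hD n) (hC n))
    rw [← add_mul]
    gcongr
    exact norm_sub_le _ _

/-- The equation for `n = 0` involves only two values and the leading coefficient `(n + 1) ρ` never
vanishes, so the initial value determines the rest. -/
lemma recurrence_unique_of_zero {ρ : ℝ} (hρ0 : 0 < ρ) {θ : ℂ} {p q : ℕ → ℂ}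
    (hp : SolvesRecurrence ρ θ p) (hq : SolvesRecurrence ρ θ q) (h0 : p 0 = q 0) (n : ℕ) :
    p n = q n := by
  induction n using Nat.strong_induction_on with
  | _ n ih =>
    rcases n with _ | n
    · exact h0
    · have h1 := hp n
      have h2 := hq n
      rw [ih n (Nat.lt_succ_self n), ih (n - 1) (by omega)] at h1
      have h3 : ((n : ℂ) + 1) * ρ ≠ 0 :=
        mul_ne_zero (Nat.cast_add_one_ne_zero n) (by exact_mod_cast hρ0.ne')
      exact mul_left_cancel₀ h3 (by linear_combination h1 - h2)

/-! ### Variation of constants and summation by parts. -/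

section Green

variable {ρ : ℝ} {θ : ℂ} {Q h : ℕ → ℂ}

/-- Abel's identity: the factor `ρ^(n+1) (n+1)` makes the Casoratian constant in `n`, and the defect
of `Q` at `0` with `h 0 = 1` fixes the constant. -/
lemma casoratian
    (hQ : ∀ n : ℕ, n ≠ 0 → ((n : ℂ) + 1) * ρ * Q (n + 1) - ((n : ℂ) + 1) * (1 + ρ + θ) * Q n
      + n * Q (n - 1) = 0)
    (hQ0 : ρ * Q 1 - (1 + ρ + θ) * Q 0 = -1)
    (hh : ∀ n : ℕ, ((n : ℂ) + 1) * ρ * h (n + 1) - ((n : ℂ) + 1) * (1 + ρ + θ) * h n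
      + n * h (n - 1) = 0) (h0 : h 0 = 1) (n : ℕ) :
    (ρ : ℂ) ^ (n + 1) * ((n : ℂ) + 1) * (Q (n + 1) * h n - h (n + 1) * Q n) = -1 := by
  induction n with
  | zero =>
    have := hh 0
    simp only [h0, Nat.cast_zero, zero_add, zero_mul, add_zero, pow_one, one_mul] at this ⊢
    linear_combination hQ0 - Q 0 * this
  | succ n ih =>
    have h1 := hQ (n + 1) n.succ_ne_zero
    have h2 := hh (n + 1)
    simp only [Nat.add_sub_cancel] at h1 h2
    push_cast at h1 h2 ⊢
    rw [← ih]
    linear_combination (ρ : ℂ) ^ (n + 1) * (h (n + 1) * h1 - Q (n + 1) * h2)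

/-- Variation of constants: the Green's function built from a solution `Q` that fails the
homogeneous equation only at `0` and a solution `h` solves the inhomogeneous equation. -/
lemma solvesRecurrence_green
    (hQ : ∀ n : ℕ, n ≠ 0 → ((n : ℂ) + 1) * ρ * Q (n + 1) - ((n : ℂ) + 1) * (1 + ρ + θ) * Q n
      + n * Q (n - 1) = 0)
    (hQ0 : ρ * Q 1 - (1 + ρ + θ) * Q 0 = -1)
    (hh : ∀ n : ℕ, ((n : ℂ) + 1) * ρ * h (n + 1) - ((n : ℂ) + 1) * (1 + ρ + θ) * h n
      + n * h (n - 1) = 0) (h0 : h 0 = 1) (hs : Summable fun l : ℕ => (ρ : ℂ) ^ l * Q l) :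
    SolvesRecurrence ρ θ fun n => Q n * ∑ l ∈ Finset.range (n + 1), (ρ : ℂ) ^ l * h l +
      h n * ∑' k : ℕ, (ρ : ℂ) ^ (n + 1 + k) * Q (n + 1 + k) := by
  have hB : ∀ n, ∑' k : ℕ, (ρ : ℂ) ^ (n + k) * Q (n + k) =
      (ρ : ℂ) ^ n * Q n + ∑' k : ℕ, (ρ : ℂ) ^ (n + 1 + k) * Q (n + 1 + k) := by
    intro n
    have h1 : Summable fun k : ℕ => (ρ : ℂ) ^ (n + k) * Q (n + k) := by
      simpa only [add_comm n] using (summable_nat_add_iff n).2 hs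
    rw [h1.tsum_eq_zero_add]
    simp only [add_zero, add_assoc, add_comm 1]
  intro n
  have e1 := hB (n + 1)
  -- For `n = 0` the right side `-1` is the defect of `Q`; for larger `n` it is the Casoratian.
  rcases n with _ | n
  · have := hh 0
    simp only [Nat.cast_zero, zero_add, zero_mul, add_zero, one_mul, Finset.range_one,
      Finset.sum_singleton, pow_zero, h0, Finset.sum_range_succ] at this e1 ⊢
    rw [e1]
    linear_combination hQ0 + (∑' k : ℕ, (ρ : ℂ) ^ (1 + 1 + k) * Q (1 + 1 + k)) * this
      + (ρ : ℂ) * Q 1 * this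
  · have e0 := hB (n + 1)
    have c := casoratian hQ hQ0 hh h0 n
    have h1 := hQ (n + 1) n.succ_ne_zero
    have h2 := hh (n + 1)
    simp only [Nat.add_sub_cancel] at h1 h2 ⊢
    rw [Finset.sum_range_succ _ (n + 1 + 1), Finset.sum_range_succ _ (n + 1)]
    rw [e0, e1]
    set A := ∑ l ∈ Finset.range (n + 1), (ρ : ℂ) ^ l * h l
    set B := ∑' k : ℕ, (ρ : ℂ) ^ (n + 1 + 1 + 1 + k) * Q (n + 1 + 1 + 1 + k)
    push_cast at h1 h2 ⊢
    linear_combination (A + ρ ^ (n + 1) * h (n + 1)) * h1 +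
      (B + ρ ^ (n + 1 + 1) * Q (n + 1 + 1)) * h2 + c

/-- Summation by parts against the decaying solution. -/
lemma sum_eq_of_solvesRecurrence
    (hQ : ∀ n : ℕ, n ≠ 0 → ((n : ℂ) + 1) * ρ * Q (n + 1) - ((n : ℂ) + 1) * (1 + ρ + θ) * Q n
      + n * Q (n - 1) = 0)
    (hQ0 : ρ * Q 1 - (1 + ρ + θ) * Q 0 = -1) {p : ℕ → ℂ} (hp : SolvesRecurrence ρ θ p) (n : ℕ) :
    ∑ l ∈ Finset.range (n + 1), (ρ : ℂ) ^ l * Q l =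
      p 0 - ((n : ℂ) + 1) * ρ ^ (n + 1) * (p (n + 1) * Q n - p n * Q (n + 1)) := by
  induction n with
  | zero =>
    have := hp 0
    simp only [Nat.cast_zero, zero_add, zero_mul, add_zero, one_mul, Finset.range_one,
      Finset.sum_singleton, pow_zero, pow_one] at this ⊢
    linear_combination Q 0 * this - p 0 * hQ0
  | succ n ih =>
    have h1 := hQ (n + 1) n.succ_ne_zero
    have h2 := hp (n + 1)
    simp only [Nat.add_sub_cancel] at h1 h2
    rw [Finset.sum_range_succ, ih]
    push_cast at h1 h2 ⊢
    linear_combination (ρ : ℂ) ^ (n + 1) * (Q (n + 1) * h2 - p (n + 1) * h1)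

/-- In the summation by parts, `p n = O(ρ^(-n/2))` and `Q n = O(r^n)` make the boundary term `O(n
(√ρ r)^n)`, which tends to `0`. -/
lemma zero_eq_tsum_of_solvesRecurrence (hρ0 : 0 < ρ)
    (hQ : ∀ n : ℕ, n ≠ 0 → ((n : ℂ) + 1) * ρ * Q (n + 1) - ((n : ℂ) + 1) * (1 + ρ + θ) * Q n
      + n * Q (n - 1) = 0)
    (hQ0 : ρ * Q 1 - (1 + ρ + θ) * Q 0 = -1) (hs : Summable fun l : ℕ => (ρ : ℂ) ^ l * Q l)
    {D r : ℝ} (hr0 : 0 ≤ r) (hr : √ρ * r < 1) (hD : ∀ n, ‖Q n‖ ≤ D * r ^ n)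
    {p : ℕ → ℂ} (hp : SolvesRecurrence ρ θ p) {C : ℝ} (hC : ∀ n, ‖p n‖ * √ρ ^ n ≤ C) :
    p 0 = ∑' l : ℕ, (ρ : ℂ) ^ l * Q l := by
  have hs0 := Real.sqrt_pos.2 hρ0
  have hss := Real.mul_self_sqrt hρ0.le
  have hC0 : 0 ≤ C := le_trans (by positivity) (hC 0)
  have hD0 : 0 ≤ D := by simpa using (norm_nonneg _).trans (hD 0)
  have hbound : ∀ n : ℕ, ‖((n : ℂ) + 1) * ρ ^ (n + 1) * (p (n + 1) * Q n - p n * Q (n + 1))‖ ≤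
      C * D * √ρ * (1 + √ρ * r) * (n * (√ρ * r) ^ n + (√ρ * r) ^ n) := by
    intro n
    have hn1 : ‖(n : ℂ) + 1‖ = n + 1 := by
      rw [← Nat.cast_add_one, Complex.norm_natCast]; push_cast; rfl
    have h1 : ρ ^ (n + 1) * (‖p (n + 1)‖ * ‖Q n‖) ≤ C * D * √ρ * (√ρ * r) ^ n := by
      calc ρ ^ (n + 1) * (‖p (n + 1)‖ * ‖Q n‖)
          = (‖p (n + 1)‖ * √ρ ^ (n + 1)) * (√ρ ^ (n + 1) * ‖Q n‖) := by
            nth_rewrite 1 [← hss]; rw [mul_pow]; ring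
        _ ≤ C * (√ρ ^ (n + 1) * (D * r ^ n)) := by
            gcongr
            exacts [hC _, hD n]
        _ = _ := by rw [mul_pow]; ring
    have h2 : ρ ^ (n + 1) * (‖p n‖ * ‖Q (n + 1)‖) ≤ C * D * √ρ * (√ρ * r) * (√ρ * r) ^ n := by
      calc ρ ^ (n + 1) * (‖p n‖ * ‖Q (n + 1)‖)
          = (‖p n‖ * √ρ ^ n) * (√ρ * (√ρ ^ (n + 1) * ‖Q (n + 1)‖)) := by
            nth_rewrite 1 [← hss]; rw [mul_pow]; ring
        _ ≤ C * (√ρ * (√ρ ^ (n + 1) * (D * r ^ (n + 1)))) := by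
            gcongr
            exacts [hC _, hD _]
        _ = _ := by rw [mul_pow]; ring
    rw [norm_mul, norm_mul, norm_pow, Complex.norm_real, Real.norm_of_nonneg hρ0.le, hn1]
    calc (n + 1) * ρ ^ (n + 1) * ‖p (n + 1) * Q n - p n * Q (n + 1)‖
        ≤ (n + 1) * ρ ^ (n + 1) * (‖p (n + 1)‖ * ‖Q n‖ + ‖p n‖ * ‖Q (n + 1)‖) := by
          gcongr
          refine (norm_sub_le _ _).trans (by rw [norm_mul, norm_mul])
      _ = (n + 1) * (ρ ^ (n + 1) * (‖p (n + 1)‖ * ‖Q n‖) +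
            ρ ^ (n + 1) * (‖p n‖ * ‖Q (n + 1)‖)) := by ring
      _ ≤ (n + 1) * (C * D * √ρ * (√ρ * r) ^ n + C * D * √ρ * (√ρ * r) * (√ρ * r) ^ n) := by
          gcongr
      _ = _ := by ring
  have hlim : Filter.Tendsto (fun n : ℕ => ((n : ℂ) + 1) * ρ ^ (n + 1) *
      (p (n + 1) * Q n - p n * Q (n + 1))) Filter.atTop (nhds 0) := by
    refine squeeze_zero_norm hbound ?_
    have h1 := tendsto_self_mul_const_pow_of_lt_one (by positivity) hr
    have h2 := tendsto_pow_atTop_nhds_zero_of_lt_one (by positivity) hr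
    simpa using (h1.add h2).const_mul (C * D * √ρ * (1 + √ρ * r))
  have h3 := (Filter.tendsto_add_atTop_iff_nat 1).2 hs.hasSum.tendsto_sum_nat
  simp only [sum_eq_of_solvesRecurrence hQ hQ0 hp] at h3
  have h4 := tendsto_const_nhds (x := p 0) |>.sub hlim
  rw [sub_zero] at h4
  exact tendsto_nhds_unique h4 h3

end Green

/-- The explicit formula, for any solution of the recurrence of admissible growth. -/
lemma explicit_formula {ρ : ℝ} (hρ0 : 0 < ρ) (hρ1 : ρ < 1) {θ : ℂ}
    (hw : 2 * √ρ < (1 + ρ + θ).re) {p : ℕ → ℂ} (hp : SolvesRecurrence ρ θ p)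
    (hC : ∃ C : ℝ, ∀ n, ‖p n‖ * √ρ ^ n ≤ C) {γ : ℝ → ℂ}
    (hγ : IsContourAround γ (zMinus ρ θ) (zPlus ρ θ)) (n : ℕ) :
    p n = M ρ θ * G ρ θ n * ∑ l ∈ Finset.range (n + 1), (ρ : ℂ) ^ l * H ρ θ γ l +
      M ρ θ * H ρ θ γ n * ∑' k : ℕ, (ρ : ℂ) ^ (n + 1 + k) * G ρ θ (n + 1 + k) := by
  obtain ⟨C, hC⟩ := hC
  obtain ⟨D, hD⟩ := exists_norm_G_le hρ0 hw
  have hQ : ∀ n : ℕ, n ≠ 0 → ((n : ℂ) + 1) * ρ * (M ρ θ * G ρ θ (n + 1)) -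
      ((n : ℂ) + 1) * (1 + ρ + θ) * (M ρ θ * G ρ θ n) + n * (M ρ θ * G ρ θ (n - 1)) = 0 := by
    intro n hn
    linear_combination M ρ θ * G_recurrence hρ0 hw n hn
  have hQ0 := M_mul_G_recurrence_zero hρ0 hw
  have hs : Summable fun l : ℕ => (ρ : ℂ) ^ l * (M ρ θ * G ρ θ l) := by
    simpa only [mul_left_comm] using (summable_G hρ0 hρ1 hw).mul_left (M ρ θ)
  have hsol := solvesRecurrence_green (Q := fun n => M ρ θ * G ρ θ n) (h := H ρ θ γ) hQ hQ0
    (H_recurrence hρ0 hw hγ) (H_zero hρ0 hw hγ) hs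
  have hp0 := zero_eq_tsum_of_solvesRecurrence (Q := fun n => M ρ θ * G ρ θ n)
    (D := ‖M ρ θ‖ * D) hρ0 hQ hQ0 hs (norm_nonneg _) (norm_zMinus_lt_one hρ0 hw) (fun n => by
      rw [norm_mul, mul_assoc]
      gcongr
      exact hD n) hp hC
  -- Only the values at `0` need comparing: since `H 0 = 1`, the Green's function solution starts at
  -- the full series `∑ ρ^l M G_l`, as `p` does.
  rw [recurrence_unique_of_zero hρ0 hp hsol ?_ n]
  · simp only [mul_left_comm _ (M ρ θ), tsum_mul_left]
    ring
  · rw [hp0, hs.tsum_eq_zero_add]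
    simp [H_zero hρ0 hw hγ, add_comm]

/-! ### The jump chain -/

instance : Countable State :=
  Function.Injective.countable
    (f := fun x : State => State.rec (motive := fun _ => Option ℕ) (fun n => some n) none x) <| by
    rintro (n | _) (m | _) h <;> simp_all

instance : DiscreteMeasurableSpace State := ⟨fun _ => trivial⟩

lemma rate_succ (ρ : ℝ) (n : ℕ) : rate ρ (.present n) (.present (n + 1)) = ρ := by
  simp [rate]

lemma rate_pred (ρ : ℝ) (n : ℕ) :
    rate ρ (.present n) (.present (n - 1)) = n * (1 / (n + 1)) := by
  rcases n with _ | n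
  · simp [rate]
  · rw [rate, if_neg (by omega), if_pos (by omega)]

lemma rate_eq_zero (ρ : ℝ) {n m : ℕ} (hm : m ≠ n + 1) (hm' : m ≠ n - 1) :
    rate ρ (.present n) (.present m) = 0 := by
  rw [rate, if_neg hm, if_neg (by omega)]

/-- The two service rates add up to `1`, whatever `n` is. This state-independence makes the sojourn
time a sum of i.i.d. exponentials up to a random index. -/
lemma exitRate_present (ρ : ℝ) (n : ℕ) : exitRate ρ (.present n) = 1 + ρ := by
  have h0 : ∀ y ∉ ({.present (n + 1), .present (n - 1), .departed} : Finset State),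
      rate ρ (.present n) y = 0 := by
    rintro (m | _) hy
    · simp only [Finset.mem_insert, Finset.mem_singleton, State.present.injEq, reduceCtorEq,
        or_false, not_or] at hy
      exact rate_eq_zero ρ hy.1 hy.2
    · simp at hy
  have h1 : rate ρ (.present n) .departed = 1 / (n + 1) := rfl
  rw [exitRate, tsum_eq_sum h0, Finset.sum_insert, Finset.sum_insert, Finset.sum_singleton,
    rate_succ, rate_pred, h1]
  · field_simp
    ring
  · simp
  · simp only [Finset.mem_insert, State.present.injEq, Finset.mem_singleton, reduceCtorEq, or_false]
    omega

lemma jumpProb_present {ρ : ℝ} (hρ0 : 0 < ρ) (n : ℕ) (y : State) :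
    jumpProb ρ (.present n) y = rate ρ (.present n) y / (1 + ρ) := by
  rw [jumpProb, exitRate_present, if_neg (by positivity)]

lemma jumpProb_departed (ρ : ℝ) {y : State} (hy : y ≠ .departed) : jumpProb ρ .departed y = 0 := by
  have h : exitRate ρ .departed = 0 := by
    rw [exitRate]
    exact (tsum_congr fun y => rfl).trans tsum_zero
  rw [jumpProb, if_pos h, if_neg hy]

/-- One step of the chain restricted to the states in which the tagged customer is present. -/
noncomputable def step (ρ : ℝ) (g : ℕ → ℝ) (n : ℕ) : ℝ :=
  (ρ * g (n + 1) + n / (n + 1) * g (n - 1)) / (1 + ρ)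

lemma step_nonneg {ρ : ℝ} (hρ0 : 0 < ρ) {g : ℕ → ℝ} (hg : ∀ n, 0 ≤ g n) (n : ℕ) :
    0 ≤ step ρ g n := by
  have h1 := hg (n + 1)
  have h2 := hg (n - 1)
  unfold step
  positivity

lemma step_mono {ρ : ℝ} (hρ0 : 0 < ρ) {g h : ℕ → ℝ} (hgh : ∀ n, g n ≤ h n) (n : ℕ) :
    step ρ g n ≤ step ρ h n := by
  unfold step
  gcongr
  exacts [hgh _, hgh _]

lemma tsum_jumpProb_mul {ρ : ℝ} (hρ0 : 0 < ρ) {g : ℕ → ℝ} (hg : ∀ n, 0 ≤ g n) (n : ℕ) :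
    ∑' m, ENNReal.ofReal (jumpProb ρ (.present n) (.present m)) * ENNReal.ofReal (g m) =
      ENNReal.ofReal (step ρ g n) := by
  have h0 : ∀ m ∉ ({n + 1, n - 1} : Finset ℕ),
      ENNReal.ofReal (jumpProb ρ (.present n) (.present m)) * ENNReal.ofReal (g m) = 0 := by
    intro m hm
    simp only [Finset.mem_insert, Finset.mem_singleton, not_or] at hm
    rw [jumpProb_present hρ0, rate_eq_zero ρ hm.1 hm.2]
    simp
  rw [tsum_eq_sum h0, Finset.sum_insert (by simp only [Finset.mem_singleton]; omega),
    Finset.sum_singleton, jumpProb_present hρ0, rate_succ, jumpProb_present hρ0,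
    rate_pred,
    ← ENNReal.ofReal_mul (by positivity), ← ENNReal.ofReal_mul (by positivity),
    ← ENNReal.ofReal_add (mul_nonneg (by positivity) (hg _)) (mul_nonneg (by positivity) (hg _)),
    step]
  congr 1
  ring

/-- The probability that the tagged customer departs at the `(k+1)`-st jump, given that it finds
`n` others. -/
noncomputable def exitProb (ρ : ℝ) : ℕ → ℕ → ℝ
  | 0, n => 1 / (n + 1) / (1 + ρ)
  | k + 1, n => step ρ (exitProb ρ k) n

lemma exitProb_nonneg {ρ : ℝ} (hρ0 : 0 < ρ) (k n : ℕ) : 0 ≤ exitProb ρ k n := by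
  induction k generalizing n with
  | zero => unfold exitProb; positivity
  | succ k ih => exact step_nonneg hρ0 ih n

/-- The upward term equals `√ρ · ρ^(-n/2)`, and the downward term is at most the same because
`n/(n+1) ≤ 1`. -/
lemma step_supersolution {ρ : ℝ} (hρ0 : 0 < ρ) (n : ℕ) {c : ℝ} (hc : 0 ≤ c) :
    step ρ (fun n => (√ρ)⁻¹ ^ n * c) n ≤ (√ρ)⁻¹ ^ n * (c * (2 * √ρ / (1 + ρ))) := by
  have hs0 := Real.sqrt_pos.2 hρ0
  have hss := Real.mul_self_sqrt hρ0.le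
  have h1 : ρ * (√ρ)⁻¹ ^ (n + 1) = √ρ * (√ρ)⁻¹ ^ n := by
    rw [pow_succ]
    nth_rewrite 1 [← hss]
    field_simp
  have h2 : (n : ℝ) / (n + 1) * (√ρ)⁻¹ ^ (n - 1) ≤ √ρ * (√ρ)⁻¹ ^ n := by
    rcases n with _ | n
    · simp
    · have : √ρ * (√ρ)⁻¹ ^ (n + 1) = (√ρ)⁻¹ ^ n := by
        rw [pow_succ]; field_simp
      rw [this, Nat.add_sub_cancel]
      refine mul_le_of_le_one_left (by positivity) ?_
      rw [div_le_one (by positivity)]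
      linarith
  unfold step
  calc (ρ * ((√ρ)⁻¹ ^ (n + 1) * c) + n / (n + 1) * ((√ρ)⁻¹ ^ (n - 1) * c)) / (1 + ρ)
      = (ρ * (√ρ)⁻¹ ^ (n + 1) + n / (n + 1) * (√ρ)⁻¹ ^ (n - 1)) * c / (1 + ρ) := by ring
    _ ≤ (√ρ * (√ρ)⁻¹ ^ n + √ρ * (√ρ)⁻¹ ^ n) * c / (1 + ρ) := by
        rw [h1]; gcongr
    _ = _ := by ring

lemma one_le_inv_sqrt_pow {ρ : ℝ} (hρ0 : 0 < ρ) (hρ1 : ρ < 1) (n : ℕ) : 1 ≤ (√ρ)⁻¹ ^ n := by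
  refine one_le_pow₀ ((one_le_inv₀ (Real.sqrt_pos.2 hρ0)).2 ?_)
  rw [Real.sqrt_le_one]
  exact hρ1.le

lemma exitProb_le {ρ : ℝ} (hρ0 : 0 < ρ) (hρ1 : ρ < 1) (k n : ℕ) :
    exitProb ρ k n ≤ (√ρ)⁻¹ ^ n * (2 * √ρ / (1 + ρ)) ^ k := by
  induction k generalizing n with
  | zero =>
    rw [pow_zero, mul_one]
    refine le_trans ?_ (one_le_inv_sqrt_pow hρ0 hρ1 n)
    unfold exitProb
    rw [div_div, div_le_one (by positivity)]
    nlinarith [(Nat.cast_nonneg n : (0 : ℝ) ≤ n)]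
  | succ k ih =>
    refine (step_mono hρ0 ih n).trans ((step_supersolution hρ0 n (by positivity)).trans_eq ?_)
    rw [pow_succ]

lemma two_sqrt_lt_one_add {ρ : ℝ} (hρ0 : 0 < ρ) (hρ1 : ρ < 1) : 2 * √ρ < 1 + ρ := by
  have hss := Real.sq_sqrt hρ0.le
  have : √ρ < 1 := by rw [Real.sqrt_lt' one_pos]; simpa using hρ1
  nlinarith [mul_pos (sub_pos.2 this) (sub_pos.2 this)]

/-- The event that the tagged customer departs at the `m`-th jump. -/
def exitAt {Ω : Type*} (X : ℕ → Ω → State) (m : ℕ) : Set Ω :=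
  {ω | X m ω = .departed ∧ ∀ i < m, X i ω ≠ .departed}

/-- Only the prefix of the path `x` matters in these events, so `Function.update` serves to extend a
path by one state. -/
lemma update_prefix_eq {Ω : Type*} (X : ℕ → Ω → State) (j : ℕ) (x : ℕ → State) (y : State) :
    {ω | ∀ i ≤ j + 1, X i ω = Function.update x (j + 1) y i} =
      {ω | ∀ i ≤ j, X i ω = x i} ∩ {ω | X (j + 1) ω = y} := by
  ext ω
  simp only [mem_ofPred_eq, mem_inter_iff]
  constructor
  · intro h
    refine ⟨fun i hi => ?_, ?_⟩
    · rw [h i (by omega), Function.update_of_ne (by omega)]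
    · rw [h _ le_rfl, Function.update_self]
  · rintro ⟨h1, h2⟩ i hi
    rcases Nat.lt_or_ge j i with h | h
    · obtain rfl : i = j + 1 := by omega
      rw [h2, Function.update_self]
    · rw [h1 i h, Function.update_of_ne (by omega)]

section Measurability

variable {Ω : Type*} [MeasurableSpace Ω] {X : ℕ → Ω → State}

lemma measurableSet_X_eq (hX : ∀ k, Measurable (X k)) (i : ℕ) (x : State) :
    MeasurableSet {ω | X i ω = x} :=
  hX i (measurableSet_singleton x)

lemma measurableSet_prefix (hX : ∀ k, Measurable (X k)) (j : ℕ) (x : ℕ → State) :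
    MeasurableSet {ω | ∀ i ≤ j, X i ω = x i} := by
  simp only [ofPred_forall]
  exact MeasurableSet.iInter fun i => MeasurableSet.iInter fun _ => measurableSet_X_eq hX i _

lemma measurableSet_exitAt (hX : ∀ k, Measurable (X k)) (m : ℕ) : MeasurableSet (exitAt X m) := by
  have h : exitAt X m = {ω | X m ω = .departed} ∩ ⋂ i, ⋂ (_ : i < m), {ω | X i ω = .departed}ᶜ := by
    ext ω
    simp [exitAt]
  rw [h]
  exact (measurableSet_X_eq hX m _).inter (MeasurableSet.iInter fun i =>
    MeasurableSet.iInter fun _ => (measurableSet_X_eq hX i _).compl)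

end Measurability

/-! ### Path probabilities of the jump chain. -/

section Chain

variable {Ω : Type*} [MeasurableSpace Ω] {P : Measure Ω} {ρ : ℝ}
  {X : ℕ → Ω → State} {E : ℕ → Ω → ℝ}

lemma measure_update_prefix (hQ : IsTaggedQueue P ρ X E) (j : ℕ) (x : ℕ → State) (y : State) :
    P {ω | ∀ i ≤ j + 1, X i ω = Function.update x (j + 1) y i} =
      P {ω | ∀ i ≤ j, X i ω = x i} * ENNReal.ofReal (jumpProb ρ (x j) y) := by
  rw [hQ.markov j (Function.update x (j + 1) y), Function.update_self,
    Function.update_of_ne (by omega)]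
  congr 2
  ext ω
  refine forall₂_congr fun i hi => ?_
  rw [Function.update_of_ne (by omega)]

lemma measure_prefix_inter (hQ : IsTaggedQueue P ρ X E) (j : ℕ) (x : ℕ → State) {B : Set Ω}
    (hB : MeasurableSet B) (hBX : ∀ ω ∈ B, X (j + 1) ω ≠ .departed) :
    P ({ω | ∀ i ≤ j, X i ω = x i} ∩ B) =
      ∑' m, P ({ω | ∀ i ≤ j + 1, X i ω = Function.update x (j + 1) (.present m) i} ∩ B) := by
  rw [← measure_iUnion]
  · congr 1
    ext ω
    simp only [update_prefix_eq, mem_inter_iff, mem_iUnion, mem_ofPred_eq]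
    constructor
    · rintro ⟨h1, h2⟩
      rcases hX : X (j + 1) ω with m | _
      · exact ⟨m, ⟨h1, rfl⟩, h2⟩
      · exact absurd hX (hBX ω h2)
    · rintro ⟨m, ⟨h1, -⟩, h2⟩
      exact ⟨h1, h2⟩
  · intro m m' hm
    refine Set.disjoint_left.2 fun ω h1 h2 => hm ?_
    simp only [update_prefix_eq] at h1 h2
    have := h1.1.2.symm.trans h2.1.2
    simpa using this
  · exact fun m => (measurableSet_prefix hQ.measurable_X _ _).inter hB

/-- Induction on `k`, conditioning on the next state. All prefixes are treated at once because the
inductive step lengthens the prefix. Index `k = 0` is departure at the very next jump. -/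
lemma measure_prefix_inter_exitAt (hρ0 : 0 < ρ) (hQ : IsTaggedQueue P ρ X E) (k : ℕ) :
    ∀ (j : ℕ) (x : ℕ → State) (n : ℕ), (∀ i ≤ j, x i ≠ .departed) → x j = .present n →
      P ({ω | ∀ i ≤ j, X i ω = x i} ∩ exitAt X (j + 1 + k)) =
        P {ω | ∀ i ≤ j, X i ω = x i} * ENNReal.ofReal (exitProb ρ k n) := by
  induction k with
  | zero =>
    intro j x n hx hn
    have h1 : {ω | ∀ i ≤ j, X i ω = x i} ∩ exitAt X (j + 1 + 0) =
        {ω | ∀ i ≤ j + 1, X i ω = Function.update x (j + 1) .departed i} := by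
      rw [update_prefix_eq]
      ext ω
      simp only [exitAt, mem_inter_iff, mem_ofPred_eq, add_zero]
      refine ⟨fun h => ⟨h.1, h.2.1⟩, fun h => ⟨h.1, h.2, fun i hi => ?_⟩⟩
      rw [h.1 i (by omega)]
      exact hx i (by omega)
    rw [h1, measure_update_prefix hQ, hn, jumpProb_present hρ0]
    rfl
  | succ k ih =>
    intro j x n hx hn
    rw [measure_prefix_inter hQ j x (measurableSet_exitAt hQ.measurable_X _)
      (fun ω hω => hω.2 (j + 1) (by omega))]
    have h1 : ∀ m, P ({ω | ∀ i ≤ j + 1, X i ω = Function.update x (j + 1) (.present m) i} ∩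
        exitAt X (j + 1 + (k + 1))) = P {ω | ∀ i ≤ j, X i ω = x i} *
          (ENNReal.ofReal (jumpProb ρ (.present n) (.present m)) *
            ENNReal.ofReal (exitProb ρ k m)) := by
      intro m
      rw [show j + 1 + (k + 1) = j + 1 + 1 + k by ring, ih (j + 1) _ m ?_ (Function.update_self ..),
        measure_update_prefix hQ, hn, mul_assoc]
      intro i hi
      rcases Nat.lt_or_ge j i with h | h
      · obtain rfl : i = j + 1 := by omega
        simp
      · rw [Function.update_of_ne (by omega)]
        exact hx i h
    simp_rw [h1]
    rw [ENNReal.tsum_mul_left, tsum_jumpProb_mul hρ0 (exitProb_nonneg hρ0 k)]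
    rfl

lemma measure_inter_exitAt (hρ0 : 0 < ρ) (hQ : IsTaggedQueue P ρ X E) (n k : ℕ) :
    P ({ω | X 0 ω = .present n} ∩ exitAt X (k + 1)) =
      P {ω | X 0 ω = .present n} * ENNReal.ofReal (exitProb ρ k n) := by
  have h := measure_prefix_inter_exitAt hρ0 hQ k 0 (fun _ => .present n) n (by simp) rfl
  simpa [add_comm 1 k] using h

/-- The same conditioning bounds survival through `k` further jumps: the supersolution starts above
`1` and shrinks geometrically at each step. -/
lemma measure_prefix_inter_present_le (hρ0 : 0 < ρ) (hρ1 : ρ < 1) (hQ : IsTaggedQueue P ρ X E)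
    (k : ℕ) : ∀ (j : ℕ) (x : ℕ → State) (n : ℕ), x j = .present n →
      P ({ω | ∀ i ≤ j, X i ω = x i} ∩ {ω | ∀ i ≤ k, X (j + i) ω ≠ .departed}) ≤
        P {ω | ∀ i ≤ j, X i ω = x i} *
          ENNReal.ofReal ((√ρ)⁻¹ ^ n * (2 * √ρ / (1 + ρ)) ^ k) := by
  induction k with
  | zero =>
    intro j x n hn
    refine (measure_mono inter_subset_left).trans (le_mul_of_one_le_right' ?_)
    rw [pow_zero, mul_one, ENNReal.one_le_ofReal]
    exact one_le_inv_sqrt_pow hρ0 hρ1 n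
  | succ k ih =>
    intro j x n hn
    rw [measure_prefix_inter hQ j x (B := {ω | ∀ i ≤ k + 1, X (j + i) ω ≠ .departed}) ?_
      (fun ω hω => hω 1 (by omega))]
    · have h1 : ∀ m, P ({ω | ∀ i ≤ j + 1, X i ω = Function.update x (j + 1) (.present m) i} ∩
          {ω | ∀ i ≤ k + 1, X (j + i) ω ≠ .departed}) ≤ P {ω | ∀ i ≤ j, X i ω = x i} *
            (ENNReal.ofReal (jumpProb ρ (.present n) (.present m)) *
              ENNReal.ofReal ((√ρ)⁻¹ ^ m * (2 * √ρ / (1 + ρ)) ^ k)) := by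
        intro m
        rw [← mul_assoc, ← hn, ← measure_update_prefix hQ]
        refine (measure_mono (inter_subset_inter_right _ ?_)).trans
          (ih (j + 1) _ m (Function.update_self ..))
        intro ω hω i hi
        rw [add_assoc, add_comm 1]
        exact hω (i + 1) (by omega)
      refine (ENNReal.tsum_le_tsum h1).trans ?_
      rw [ENNReal.tsum_mul_left, tsum_jumpProb_mul hρ0 (fun m => by positivity)]
      gcongr
      refine (step_supersolution hρ0 n (by positivity)).trans_eq ?_
      rw [pow_succ]
    · simp only [ofPred_forall]
      exact MeasurableSet.iInter fun i => MeasurableSet.iInter fun _ =>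
        (measurableSet_X_eq hQ.measurable_X _ _).compl

/-- The tagged customer departs after finitely many jumps. -/
lemma ae_exists_departed [IsProbabilityMeasure P] (hρ0 : 0 < ρ) (hρ1 : ρ < 1)
    (hQ : IsTaggedQueue P ρ X E) : ∀ᵐ ω ∂P, ∃ m, X m ω = .departed := by
  have hlim : ∀ n : ℕ, Filter.Tendsto (fun k : ℕ =>
      ENNReal.ofReal ((√ρ)⁻¹ ^ n * (2 * √ρ / (1 + ρ)) ^ k)) Filter.atTop (nhds 0) := by
    intro n
    rw [← ENNReal.ofReal_zero]
    refine ENNReal.tendsto_ofReal ?_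
    simpa using (tendsto_pow_atTop_nhds_zero_of_lt_one (by positivity)
      ((div_lt_one (by positivity)).2 (two_sqrt_lt_one_add hρ0 hρ1))).const_mul ((√ρ)⁻¹ ^ n)
  have hnull : ∀ n : ℕ, P ({ω | X 0 ω = .present n} ∩ {ω | ∀ m, X m ω ≠ .departed}) = 0 := by
    intro n
    refine le_antisymm (ge_of_tendsto' (hlim n) fun k => ?_) zero_le
    have h := measure_prefix_inter_present_le hρ0 hρ1 hQ k 0 (fun _ => .present n) n rfl
    refine le_trans (measure_mono ?_) (h.trans (mul_le_of_le_one_left zero_le prob_le_one))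
    rintro ω ⟨h1, h2⟩
    refine ⟨fun i hi => ?_, fun i _ => h2 _⟩
    obtain rfl : i = 0 := by omega
    exact h1
  rw [ae_iff]
  refine measure_mono_null ?_ (measure_iUnion_null hnull)
  intro ω hω
  simp only [mem_ofPred_eq, not_exists] at hω
  rcases h : X 0 ω with n | _
  · exact mem_iUnion.2 ⟨n, h, hω⟩
  · exact absurd h (hω 0)

lemma ae_absorbed (hQ : IsTaggedQueue P ρ X E) :
    ∀ᵐ ω ∂P, ∀ m, X m ω = .departed → ∀ i, m ≤ i → X i ω = .departed := by
  have hstep : ∀ᵐ ω ∂P, ∀ m, X m ω = .departed → X (m + 1) ω = .departed := by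
    refine ae_all_iff.2 fun m => ?_
    rw [ae_iff]
    -- Finite paths of length `m + 2` form a countable type, unlike infinite ones, so the
    -- exceptional event is a countable union of events with a forbidden transition.
    have hcov : {ω | ¬(X m ω = .departed → X (m + 1) ω = .departed)} ⊆
        ⋃ x : {x : Fin (m + 2) → State // x ⟨m, by omega⟩ = .departed ∧
          x ⟨m + 1, by omega⟩ ≠ .departed},
          {ω | ∀ i ≤ m + 1, X i ω =
            (fun i : ℕ => if h : i < m + 2 then x.1 ⟨i, h⟩ else .departed) i} := by
      intro ω hω
      simp only [mem_ofPred_eq, Classical.not_imp] at hω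
      refine mem_iUnion.2 ⟨⟨fun i => X i ω, hω⟩, fun i hi => ?_⟩
      simp [show i < m + 2 by omega]
    refine measure_mono_null hcov (measure_iUnion_null fun x => ?_)
    rw [hQ.markov]
    simp only [show m < m + 2 by omega, show m + 1 < m + 2 by omega, dif_pos, x.2.1,
      jumpProb_departed ρ x.2.2, ENNReal.ofReal_zero, mul_zero]
  filter_upwards [hstep] with ω hω m hm i hi
  induction i, hi using Nat.le_induction with
  | base => exact hm
  | succ i _ ih => exact hω i ih

end Chain

/-! ### Sums of independent exponential variables -/

lemma expMeasure_one_eq : expMeasure 1 =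
    (volume.restrict (Ioi 0)).withDensity (fun x => ENNReal.ofReal (Real.exp (-x))) := by
  have h : expMeasure 1 = volume.withDensity (exponentialPDF 1) := rfl
  rw [h, ← withDensity_indicator measurableSet_Ioi]
  refine withDensity_congr_ae ?_
  have h0 : ∀ᵐ x : ℝ ∂volume, x ≠ 0 := by simp [ae_iff]
  filter_upwards [h0] with x hx
  rcases lt_or_gt_of_ne hx with h | h
  · rw [exponentialPDF_of_neg h, indicator_of_notMem (by simpa using h.le)]
  · rw [exponentialPDF_of_nonneg h.le, indicator_of_mem (by simpa using h)]
    simp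

lemma lintegral_exp_expMeasure {a : ℝ} (ha : 0 < 1 + a) :
    ∫⁻ x, ENNReal.ofReal (Real.exp (-(a * x))) ∂expMeasure 1 = ENNReal.ofReal (1 / (1 + a)) := by
  rw [expMeasure_one_eq, lintegral_withDensity_eq_lintegral_mul _ (by fun_prop) (by fun_prop)]
  have h : ∀ x : ℝ, ENNReal.ofReal (Real.exp (-x)) * ENNReal.ofReal (Real.exp (-(a * x))) =
      ENNReal.ofReal (Real.exp (-(1 + a) * x)) := by
    intro x
    rw [← ENNReal.ofReal_mul (Real.exp_nonneg _), ← Real.exp_add]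
    congr 2
    ring
  simp only [Pi.mul_apply, h]
  rw [← ofReal_integral_eq_lintegral_ofReal (integrableOn_exp_mul_Ioi (by linarith) 0)
    (ae_of_all _ fun x => Real.exp_nonneg _), integral_exp_mul_Ioi (by linarith)]
  rw [mul_zero, Real.exp_zero, neg_div_neg_eq]

lemma integral_exp_expMeasure {c : ℂ} (hc : 0 < (1 + c).re) :
    ∫ x : ℝ, Complex.exp (-(c * x)) ∂expMeasure 1 = 1 / (1 + c) := by
  rw [expMeasure_one_eq, integral_withDensity_eq_integral_toReal_smul (by fun_prop)
    (ae_of_all _ fun x => ENNReal.ofReal_lt_top)]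
  have h : ∀ x : ℝ, (ENNReal.ofReal (Real.exp (-x))).toReal • Complex.exp (-(c * x)) =
      Complex.exp (-(1 + c) * x) := by
    intro x
    rw [ENNReal.toReal_ofReal (Real.exp_nonneg _), Complex.real_smul, Complex.ofReal_exp,
      ← Complex.exp_add]
    congr 1
    push_cast
    ring
  simp only [h]
  rw [integral_exp_mul_complex_Ioi (by rw [Complex.neg_re]; linarith), Complex.ofReal_zero,
    mul_zero, Complex.exp_zero, neg_div_neg_eq]

lemma ae_pos_expMeasure : ∀ᵐ x ∂expMeasure 1, 0 < x := by
  rw [expMeasure_one_eq]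
  exact (withDensity_absolutelyContinuous _ _).ae_le (ae_restrict_mem measurableSet_Ioi)

/-- The total time spent before the `m`-th jump. -/
noncomputable def jumpTime {Ω : Type*} (ρ : ℝ) (E : ℕ → Ω → ℝ) (m : ℕ) (ω : Ω) : ℝ :=
  (∑ i ∈ Finset.range m, E i ω) / (1 + ρ)

lemma exitAt_unique {Ω : Type*} {X : ℕ → Ω → State} {ω : Ω} {k m : ℕ} (hk : ω ∈ exitAt X k)
    (hm : ω ∈ exitAt X m) : k = m := by
  rcases lt_trichotomy k m with h | h | h
  · exact absurd hk.1 (hm.2 k h)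
  · exact h
  · exact absurd hm.1 (hk.2 m h)

section Queue

variable {Ω : Type*} [MeasurableSpace Ω] {P : Measure Ω} {ρ : ℝ}
  {X : ℕ → Ω → State} {E : ℕ → Ω → ℝ}

lemma measurable_jumpTime (hE : ∀ k, Measurable (E k)) (m : ℕ) : Measurable (jumpTime ρ E m) :=
  (Finset.measurable_fun_sum _ fun i _ => hE i).div_const _

/-- Here `a` may be negative. The formula in `ℝ≥0∞` needs no prior integrability and supplies it for
the complex transform. -/
lemma lintegral_exp_jumpTime (hρ0 : 0 < ρ) (hQ : IsTaggedQueue P ρ X E) {a : ℝ}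
    (ha : 0 < 1 + ρ + a) (m : ℕ) :
    ∫⁻ t, ENNReal.ofReal (Real.exp (-(a * t))) ∂P.map (jumpTime ρ E m) =
      ENNReal.ofReal (((1 + ρ) / (1 + ρ + a)) ^ m) := by
  have h1 : ∀ ω, ENNReal.ofReal (Real.exp (-(a * jumpTime ρ E m ω))) =
      ∏ i ∈ Finset.range m, ENNReal.ofReal (Real.exp (-(a / (1 + ρ) * E i ω))) := by
    intro ω
    rw [← ENNReal.ofReal_prod_of_nonneg fun i _ => Real.exp_nonneg _, ← Real.exp_sum,
      Finset.sum_neg_distrib, ← Finset.mul_sum, jumpTime]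
    congr 3
    ring
  have hind : iIndepFun (fun i ω => ENNReal.ofReal (Real.exp (-(a / (1 + ρ) * E i ω)))) P :=
    hQ.iIndep_E.comp (fun _ x => ENNReal.ofReal (Real.exp (-(a / (1 + ρ) * x))))
      fun _ => by fun_prop
  have hone : ∀ i, ∫⁻ ω, ENNReal.ofReal (Real.exp (-(a / (1 + ρ) * E i ω))) ∂P =
      ENNReal.ofReal ((1 + ρ) / (1 + ρ + a)) := by
    intro i
    rw [← lintegral_map (f := fun x => ENNReal.ofReal (Real.exp (-(a / (1 + ρ) * x))))
      (by fun_prop) (hQ.measurable_E i), hQ.law_E, lintegral_exp_expMeasure]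
    · congr 1
      field_simp
    · have : 1 + a / (1 + ρ) = (1 + ρ + a) / (1 + ρ) := by field_simp
      rw [this]
      positivity
  rw [lintegral_map (by fun_prop) (measurable_jumpTime hQ.measurable_E m)]
  simp only [h1]
  rw [lintegral_prod_eq_prod_lintegral_of_indepFun _ _ hind fun i => by
    have := hQ.measurable_E i
    fun_prop]
  simp only [hone, Finset.prod_const, Finset.card_range]
  rw [ENNReal.ofReal_pow (by positivity)]

lemma integral_exp_jumpTime (hρ0 : 0 < ρ) (hQ : IsTaggedQueue P ρ X E) {θ : ℂ}
    (hθ : 0 < (1 + ρ + θ).re) (m : ℕ) :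
    ∫ t : ℝ, Complex.exp (-θ * t) ∂P.map (jumpTime ρ E m) =
      ((1 + ρ) / (1 + ρ + θ)) ^ m := by
  have hρ' : (1 + ρ : ℂ) ≠ 0 := by
    have : (1 + ρ : ℝ) ≠ 0 := by positivity
    exact_mod_cast this
  have h1 : ∀ ω, Complex.exp (-θ * jumpTime ρ E m ω) =
      ∏ i : Fin m, Complex.exp (-(θ / (1 + ρ) * E i ω)) := by
    intro ω
    rw [← Complex.exp_sum, Finset.sum_neg_distrib, ← Finset.mul_sum,
      Fin.sum_univ_eq_sum_range (fun i => (E i ω : ℂ)), jumpTime]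
    congr 1
    push_cast
    ring
  have hind : iIndepFun (fun (i : Fin m) => E i) P :=
    hQ.iIndep_E.precomp Fin.val_injective
  have hone : ∀ i, ∫ ω, Complex.exp (-(θ / (1 + ρ) * E i ω)) ∂P =
      (1 + ρ) / (1 + ρ + θ) := by
    intro i
    rw [← integral_map (f := fun x : ℝ => Complex.exp (-(θ / (1 + ρ) * x)))
      (hQ.measurable_E i).aemeasurable (by fun_prop), hQ.law_E, integral_exp_expMeasure]
    · field_simp
    · have : (1 + θ / (1 + ρ) : ℂ) = (((1 + ρ)⁻¹ : ℝ) : ℂ) * (1 + ρ + θ) := by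
        push_cast; field_simp
      rw [this, Complex.re_ofReal_mul]
      positivity
  rw [integral_map (measurable_jumpTime hQ.measurable_E m).aemeasurable (by fun_prop)]
  simp only [h1]
  rw [hind.integral_fun_prod_comp (f := fun _ x => Complex.exp (-(θ / (1 + ρ) * (x : ℝ))))
    (fun i => (hQ.measurable_E i).aemeasurable) fun i => by fun_prop]
  simp only [hone, Finset.prod_const, Finset.card_univ, Fintype.card_fin]

/-- The last summand is independent of the others and has a density, and convolution keeps absolute
continuity. At least one summand is needed, hence `m + 1`. -/
lemma map_jumpTime_absolutelyContinuous [IsProbabilityMeasure P] (hρ0 : 0 < ρ)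
    (hQ : IsTaggedQueue P ρ X E) (m : ℕ) : P.map (jumpTime ρ E (m + 1)) ≪ volume := by
  have hE := hQ.measurable_E
  have hind : IndepFun (∑ i ∈ Finset.range m, E i) (E m) P :=
    hQ.iIndep_E.indepFun_sum_range_succ hE m
  have hmeas : Measurable (∑ i ∈ Finset.range m, E i) := by
    have h := Finset.measurable_fun_sum (Finset.range m) fun i _ => hE i
    rwa [← Finset.sum_fn] at h
  have hsum : P.map (∑ i ∈ Finset.range m, E i + E m) ≪ volume := by
    rw [hind.map_add_eq_map_conv_map hmeas (hE m), hQ.law_E]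
    have : IsProbabilityMeasure (expMeasure 1) := isProbabilityMeasure_expMeasure one_pos
    exact Measure.conv_absolutelyContinuous (withDensity_absolutelyContinuous _ _)
  refine Measure.AbsolutelyContinuous.mk fun s hs h0 => ?_
  rw [Measure.map_apply (measurable_jumpTime hE _) hs]
  have h1 : jumpTime ρ E (m + 1) ⁻¹' s =
      (∑ i ∈ Finset.range m, E i + E m) ⁻¹' ((fun x => x * (1 + ρ)⁻¹) ⁻¹' s) := by
    ext ω
    simp [jumpTime, Finset.sum_range_succ, div_eq_mul_inv]
  rw [h1, ← Measure.map_apply (hmeas.add (hE m))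
    ((measurable_mul_const (1 + ρ)⁻¹) hs)]
  refine hsum ?_
  rw [Real.volume_preimage_mul_right (by positivity), h0, mul_zero]

lemma ae_forall_pos (hQ : IsTaggedQueue P ρ X E) : ∀ᵐ ω ∂P, ∀ k, 0 < E k ω := by
  refine ae_all_iff.2 fun k => ?_
  have h := ae_pos_expMeasure
  rw [← hQ.law_E k] at h
  exact ae_of_ae_map (hQ.measurable_E k).aemeasurable h

/-! ### The law of the sojourn time -/

/-- Before departure every holding time is `E k / (1 + ρ)`; absorption removes all later terms of
the series. -/
lemma ae_sojournTime_eq (hρ0 : 0 < ρ) (hQ : IsTaggedQueue P ρ X E) :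
    ∀ᵐ ω ∂P, ∀ m, ω ∈ exitAt X m → sojournTime ρ X E ω = ENNReal.ofReal (jumpTime ρ E m ω) := by
  filter_upwards [ae_absorbed hQ, ae_forall_pos hQ] with ω habs hpos m hm
  have h0 : ∀ k ∉ Finset.range m, (if X k ω = .departed then 0 else
      ENNReal.ofReal (E k ω / exitRate ρ (X k ω))) = 0 := by
    intro k hk
    rw [if_pos (habs m hm.1 k (by simpa using hk))]
  rw [sojournTime, tsum_eq_sum h0, jumpTime, Finset.sum_div,
    ENNReal.ofReal_sum_of_nonneg fun i _ => div_nonneg (hpos i).le (by positivity)]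
  refine Finset.sum_congr rfl fun k hk => ?_
  have hk' := hm.2 k (Finset.mem_range.1 hk)
  rw [if_neg hk']
  rcases hX : X k ω with n | _
  · rw [exitRate_present]
  · exact absurd hX hk'

lemma ae_exists_exitAt [IsProbabilityMeasure P] (hρ0 : 0 < ρ) (hρ1 : ρ < 1)
    (hQ : IsTaggedQueue P ρ X E) : ∀ᵐ ω ∂P, ∃ m, ω ∈ exitAt X m := by
  classical
  filter_upwards [ae_exists_departed hρ0 hρ1 hQ] with ω h
  exact ⟨Nat.find h, Nat.find_spec h, fun i hi => Nat.find_min h hi⟩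

lemma ae_sojournTime_lt_top [IsProbabilityMeasure P] (hρ0 : 0 < ρ) (hρ1 : ρ < 1)
    (hQ : IsTaggedQueue P ρ X E) : ∀ᵐ ω ∂P, sojournTime ρ X E ω < ∞ := by
  filter_upwards [ae_exists_exitAt hρ0 hρ1 hQ, ae_sojournTime_eq hρ0 hQ] with ω ⟨m, hm⟩ h
  rw [h m hm]
  exact ENNReal.ofReal_lt_top

lemma measurable_sojournTime (hQ : IsTaggedQueue P ρ X E) : Measurable (sojournTime ρ X E) := by
  refine Measurable.tsum fun k => Measurable.ite
    (measurableSet_X_eq hQ.measurable_X k _) measurable_const ?_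
  exact ((hQ.measurable_E k).div
    ((measurable_of_countable (exitRate ρ)).comp (hQ.measurable_X k))).ennreal_ofReal

/-- Start and departure index depend on the chain alone, the jump time on the `E k` alone. To apply
independence, both events are written as preimages of sets of sequences. -/
lemma measure_inter_exitAt_inter (hρ0 : 0 < ρ) (hQ : IsTaggedQueue P ρ X E) (n k : ℕ) {B : Set ℝ}
    (hB : MeasurableSet B) :
    P ({ω | X 0 ω = .present n} ∩ exitAt X (k + 1) ∩ jumpTime ρ E (k + 1) ⁻¹' B) =
      P {ω | X 0 ω = .present n} *
        (ENNReal.ofReal (exitProb ρ k n) * P.map (jumpTime ρ E (k + 1)) B) := by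
  have h := hQ.indep.measure_inter_preimage_eq_mul
    ({x : ℕ → State | x 0 = .present n} ∩ exitAt (fun i (x : ℕ → State) => x i) (k + 1))
    (jumpTime ρ (fun i (e : ℕ → ℝ) => e i) (k + 1) ⁻¹' B)
    ((measurableSet_X_eq (fun i => measurable_pi_apply i) 0 _).inter
      (measurableSet_exitAt (fun i => measurable_pi_apply i) _))
    (measurable_jumpTime (fun i => measurable_pi_apply i) _ hB)
  rw [← mul_assoc, ← measure_inter_exitAt hρ0 hQ,
    Measure.map_apply (measurable_jumpTime hQ.measurable_E _) hB]
  exact h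

/-- Given `n` other customers at arrival, the sojourn time is a mixture of jump times. -/
lemma condLaw_eq_sum [IsProbabilityMeasure P] (hρ0 : 0 < ρ) (hρ1 : ρ < 1)
    (hQ : IsTaggedQueue P ρ X E) (n : ℕ) :
    condLaw P ρ X E n = Measure.sum fun k =>
      ENNReal.ofReal (exitProb ρ k n) • P.map (jumpTime ρ E (k + 1)) := by
  have hV : Measurable fun ω => (sojournTime ρ X E ω).toReal :=
    (measurable_sojournTime hQ).ennreal_toReal
  have hA := measurableSet_X_eq hQ.measurable_X 0 (.present n)
  have hP0 : P {ω | X 0 ω = .present n} ≠ 0 := by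
    rw [hQ.initial]
    have : 0 < (1 - ρ) * ρ ^ n := mul_pos (by linarith) (by positivity)
    simpa using this
  ext B hB
  rw [condLaw, Measure.map_apply hV hB, cond_apply hA, Measure.sum_apply _ hB]
  have hcov : ({ω | X 0 ω = .present n} ∩ (fun ω => (sojournTime ρ X E ω).toReal) ⁻¹' B : Set Ω)
      =ᵐ[P] (⋃ k, {ω | X 0 ω = .present n} ∩ exitAt X (k + 1) ∩ jumpTime ρ E (k + 1) ⁻¹' B :
        Set Ω) := by
    filter_upwards [ae_exists_exitAt hρ0 hρ1 hQ, ae_sojournTime_eq hρ0 hQ, ae_forall_pos hQ]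
      with ω ⟨m, hm⟩ hVm hpos
    have hval : (sojournTime ρ X E ω).toReal = jumpTime ρ E m ω := by
      rw [hVm m hm, ENNReal.toReal_ofReal]
      exact div_nonneg (Finset.sum_nonneg fun i _ => (hpos i).le) (by positivity)
    refine propext ?_
    change (X 0 ω = .present n ∧ (sojournTime ρ X E ω).toReal ∈ B) ↔ ω ∈ ⋃ k, _
    rw [hval, mem_iUnion]
    constructor
    · rintro ⟨h0, h1⟩
      -- Departure at index `0` is impossible when the chain starts in a present state.
      rcases m with _ | k
      · exact absurd (h0.symm.trans hm.1) (by simp)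
      · exact ⟨k, ⟨h0, hm⟩, h1⟩
    · rintro ⟨k, ⟨h0, hk⟩, h1⟩
      obtain rfl := exitAt_unique hk hm
      exact ⟨h0, h1⟩
  rw [measure_congr hcov, measure_iUnion]
  · simp only [measure_inter_exitAt_inter hρ0 hQ n _ hB]
    rw [ENNReal.tsum_mul_left, ← mul_assoc, ENNReal.inv_mul_cancel hP0 (measure_ne_top _ _),
      one_mul]
    rfl
  · intro k m hkm
    refine Set.disjoint_left.2 fun ω h1 h2 => hkm ?_
    exact Nat.succ_injective (exitAt_unique h1.1.2 h2.1.2)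
  · exact fun k => (hA.inter (measurableSet_exitAt hQ.measurable_X _)).inter
      (measurable_jumpTime hQ.measurable_E _ hB)

lemma condLaw_absolutelyContinuous [IsProbabilityMeasure P] (hρ0 : 0 < ρ) (hρ1 : ρ < 1)
    (hQ : IsTaggedQueue P ρ X E) (n : ℕ) : condLaw P ρ X E n ≪ volume := by
  rw [condLaw_eq_sum hρ0 hρ1 hQ]
  exact Measure.absolutelyContinuous_sum_left fun k =>
    Measure.smul_absolutelyContinuous.trans (map_jumpTime_absolutelyContinuous hρ0 hQ k)

instance isFiniteMeasure_condLaw (n : ℕ) : IsFiniteMeasure (condLaw P ρ X E n) := by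
  unfold condLaw
  infer_instance

lemma ae_condLaw_pos [IsProbabilityMeasure P] (hρ0 : 0 < ρ) (hρ1 : ρ < 1)
    (hQ : IsTaggedQueue P ρ X E) (n : ℕ) : ∀ᵐ t ∂condLaw P ρ X E n, t ∈ Ioi (0 : ℝ) := by
  rw [condLaw_eq_sum hρ0 hρ1 hQ, Measure.ae_sum_iff]
  intro k
  refine Measure.ae_smul_measure ?_ _
  refine (ae_map_iff (measurable_jumpTime hQ.measurable_E _).aemeasurable measurableSet_Ioi).2 ?_
  filter_upwards [ae_forall_pos hQ] with ω hω
  exact div_pos (Finset.sum_pos (fun i _ => hω i) (by simp)) (by positivity)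

/-- Radon–Nikodym on the whole line; restricting to `Ioi 0` changes nothing because the law charges
only positive times. -/
lemma condLaw_eq_withDensity [IsProbabilityMeasure P] (hρ0 : 0 < ρ) (hρ1 : ρ < 1)
    (hQ : IsTaggedQueue P ρ X E) (n : ℕ) :
    condLaw P ρ X E n = (volume.restrict (Ioi 0)).withDensity
      (fun t => ENNReal.ofReal (density P ρ X E n t)) := by
  have h1 : condLaw P ρ X E n =
      volume.withDensity (fun t => ENNReal.ofReal (density P ρ X E n t)) := by
    rw [← Measure.withDensity_rnDeriv_eq _ _ (condLaw_absolutelyContinuous hρ0 hρ1 hQ n)]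
    refine withDensity_congr_ae ?_
    filter_upwards [Measure.rnDeriv_lt_top (condLaw P ρ X E n) volume] with t ht
    rw [density, ENNReal.ofReal_toReal ht.ne]
  rw [← restrict_withDensity measurableSet_Ioi, ← h1,
    Measure.restrict_eq_self_of_ae_mem (ae_condLaw_pos hρ0 hρ1 hQ n)]

end Queue

/-! ### Laplace transforms -/

lemma summable_exitProb_bound {ρ : ℝ} (hρ0 : 0 < ρ) {r : ℝ} (hr : 2 * √ρ < r) :
    Summable fun k : ℕ => (2 * √ρ / (1 + ρ)) ^ k * ((1 + ρ) / r) ^ (k + 1) := by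
  have hr0 : 0 < r := lt_of_le_of_lt (by positivity) hr
  have h : ∀ k : ℕ, (2 * √ρ / (1 + ρ)) ^ k * ((1 + ρ) / r) ^ (k + 1) =
      (2 * √ρ / r) ^ k * ((1 + ρ) / r) := by
    intro k
    rw [pow_succ, ← mul_assoc, ← mul_pow]
    congr 2
    field_simp
  simp only [h]
  exact (summable_geometric_of_lt_one (by positivity) ((div_lt_one hr0).2 hr)).mul_right _

/-- The generating function of the number of jumps, at `(1 + ρ) / (1 + ρ + θ)`. -/
noncomputable def exitTransform (ρ : ℝ) (θ : ℂ) (n : ℕ) : ℂ :=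
  ∑' k : ℕ, (exitProb ρ k n : ℂ) * ((1 + ρ) / (1 + ρ + θ)) ^ (k + 1)

lemma norm_exitTransform_term_le {ρ : ℝ} (hρ0 : 0 < ρ) (hρ1 : ρ < 1) (θ : ℂ) (n k : ℕ) :
    ‖(exitProb ρ k n : ℂ) * ((1 + ρ) / (1 + ρ + θ)) ^ (k + 1)‖ ≤
      (√ρ)⁻¹ ^ n * ((2 * √ρ / (1 + ρ)) ^ k * ((1 + ρ) / ‖1 + ρ + θ‖) ^ (k + 1)) := by
  have h1 : ‖(1 + ρ : ℂ)‖ = 1 + ρ := by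
    rw [← Complex.ofReal_one, ← Complex.ofReal_add, Complex.norm_real,
      Real.norm_of_nonneg (by positivity)]
  rw [norm_mul, norm_pow, norm_div, h1, Complex.norm_real,
    Real.norm_of_nonneg (exitProb_nonneg hρ0 k n), ← mul_assoc]
  gcongr
  exact exitProb_le hρ0 hρ1 k n

lemma summable_exitTransform {ρ : ℝ} (hρ0 : 0 < ρ) (hρ1 : ρ < 1) {θ : ℂ}
    (hw : 2 * √ρ < (1 + ρ + θ).re) (n : ℕ) :
    Summable fun k : ℕ => (exitProb ρ k n : ℂ) * ((1 + ρ) / (1 + ρ + θ)) ^ (k + 1) :=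
  Summable.of_norm_bounded
    ((summable_exitProb_bound hρ0 (hw.trans_le (Complex.re_le_norm _))).mul_left _)
    (norm_exitTransform_term_le hρ0 hρ1 θ n)

lemma exists_norm_exitTransform_le {ρ : ℝ} (hρ0 : 0 < ρ) (hρ1 : ρ < 1) {θ : ℂ}
    (hw : 2 * √ρ < (1 + ρ + θ).re) : ∃ C : ℝ, ∀ n, ‖exitTransform ρ θ n‖ * √ρ ^ n ≤ C := by
  have hs := summable_exitProb_bound hρ0 (hw.trans_le (Complex.re_le_norm _))
  refine ⟨∑' k : ℕ, (2 * √ρ / (1 + ρ)) ^ k * ((1 + ρ) / ‖1 + ρ + θ‖) ^ (k + 1), fun n => ?_⟩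
  have h1 := tsum_of_norm_bounded (hs.mul_left ((√ρ)⁻¹ ^ n)).hasSum
    (norm_exitTransform_term_le hρ0 hρ1 θ n)
  rw [tsum_mul_left] at h1
  have hpos := pow_pos (Real.sqrt_pos.2 hρ0) n
  calc ‖exitTransform ρ θ n‖ * √ρ ^ n ≤ _ := mul_le_mul_of_nonneg_right h1 hpos.le
    _ = _ := by rw [inv_pow]; field_simp

/-- First-step analysis: the term `k = 0` is immediate departure, and the remaining series is one
application of `step` to the transforms. Clearing denominators gives the recurrence. -/
lemma solvesRecurrence_exitTransform {ρ : ℝ} (hρ0 : 0 < ρ) (hρ1 : ρ < 1) {θ : ℂ}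
    (hw : 2 * √ρ < (1 + ρ + θ).re) : SolvesRecurrence ρ θ (exitTransform ρ θ) := by
  intro n
  have hs := summable_exitTransform hρ0 hρ1 hw
  have hw0 : (1 + ρ + θ : ℂ) ≠ 0 := by
    intro h
    rw [h, Complex.zero_re] at hw
    linarith [Real.sqrt_nonneg ρ]
  have hρ' : (1 + ρ : ℂ) ≠ 0 := by
    have : (1 + ρ : ℝ) ≠ 0 := by positivity
    exact_mod_cast this
  have hn : (n + 1 : ℂ) ≠ 0 := Nat.cast_add_one_ne_zero n
  have h1 : exitTransform ρ θ n = (1 + ρ) / (1 + ρ + θ) * (1 / (n + 1) / (1 + ρ) +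
      (ρ * exitTransform ρ θ (n + 1) + n / (n + 1) * exitTransform ρ θ (n - 1)) / (1 + ρ)) := by
    have h2 : ∑' k : ℕ, (exitProb ρ (k + 1) n : ℂ) * ((1 + ρ) / (1 + ρ + θ)) ^ (k + 1) =
        (ρ * exitTransform ρ θ (n + 1) + n / (n + 1) * exitTransform ρ θ (n - 1)) / (1 + ρ) := by
      unfold exitTransform
      rw [← tsum_mul_left, ← tsum_mul_left,
        ← Summable.tsum_add ((hs _).mul_left _) ((hs _).mul_left _), ← tsum_div_const]
      refine tsum_congr fun k => ?_
      simp only [exitProb, step]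
      push_cast
      ring
    rw [exitTransform, (hs n).tsum_eq_zero_add, ← h2, mul_add, ← tsum_mul_left]
    congr 1
    · simp only [exitProb]
      push_cast
      ring
    · refine tsum_congr fun k => ?_
      ring
  have h3 : (n + 1) * (1 + ρ + θ) * exitTransform ρ θ n =
      1 + (n + 1) * ρ * exitTransform ρ θ (n + 1) + n * exitTransform ρ θ (n - 1) := by
    rw [h1]
    field_simp
    ring
  linear_combination -h3

section Queue

variable {Ω : Type*} [MeasurableSpace Ω] {P : Measure Ω} {ρ : ℝ}
  {X : ℕ → Ω → State} {E : ℕ → Ω → ℝ}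

/-- The absolute value of the integrand is `exp (-Re θ · t)`; its integral against the mixture is
dominated by a geometric series of ratio `2√ρ / (1 + ρ + Re θ) < 1`. -/
lemma integrable_exp_condLaw [IsProbabilityMeasure P] (hρ0 : 0 < ρ) (hρ1 : ρ < 1)
    (hQ : IsTaggedQueue P ρ X E) {θ : ℂ} (hw : 2 * √ρ < (1 + ρ + θ).re) (n : ℕ) :
    Integrable (fun t : ℝ => Complex.exp (-θ * t)) (condLaw P ρ X E n) := by
  refine ⟨by fun_prop, ?_⟩
  have hre : (1 + ρ + θ).re = 1 + ρ + θ.re := by simp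
  rw [hre] at hw
  have hpos : 0 < 1 + ρ + θ.re := lt_of_le_of_lt (by positivity) hw
  have h1 : ∀ t : ℝ, ‖Complex.exp (-θ * t)‖ₑ = ENNReal.ofReal (Real.exp (-(θ.re * t))) := by
    intro t
    rw [← ofReal_norm, Complex.norm_exp]
    simp
  rw [HasFiniteIntegral, condLaw_eq_sum hρ0 hρ1 hQ, lintegral_sum_measure]
  simp only [lintegral_smul_measure, h1, lintegral_exp_jumpTime hρ0 hQ hpos, smul_eq_mul]
  have hs := (summable_exitProb_bound hρ0 hw).mul_left ((√ρ)⁻¹ ^ n)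
  refine lt_of_le_of_lt (ENNReal.tsum_le_tsum fun k => ?_) hs.tsum_ofReal_lt_top
  rw [← ENNReal.ofReal_mul (exitProb_nonneg hρ0 k n), ← mul_assoc]
  gcongr
  exact exitProb_le hρ0 hρ1 k n

lemma integral_exp_condLaw [IsProbabilityMeasure P] (hρ0 : 0 < ρ) (hρ1 : ρ < 1)
    (hQ : IsTaggedQueue P ρ X E) {θ : ℂ} (hw : 2 * √ρ < (1 + ρ + θ).re) (n : ℕ) :
    ∫ t : ℝ, Complex.exp (-θ * t) ∂condLaw P ρ X E n = exitTransform ρ θ n := by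
  have h := integrable_exp_condLaw hρ0 hρ1 hQ hw n
  have hpos : 0 < (1 + ρ + θ).re := lt_of_le_of_lt (by positivity) hw
  rw [condLaw_eq_sum hρ0 hρ1 hQ] at h ⊢
  rw [integral_sum_measure h, exitTransform]
  refine tsum_congr fun k => ?_
  rw [integral_smul_measure, integral_exp_jumpTime hρ0 hQ hpos,
    ENNReal.toReal_ofReal (exitProb_nonneg hρ0 k n), Complex.real_smul]

lemma measurable_density (n : ℕ) : Measurable (density P ρ X E n) :=
  (Measure.measurable_rnDeriv _ _).ennreal_toReal

lemma density_nonneg (n : ℕ) (t : ℝ) : 0 ≤ density P ρ X E n t := ENNReal.toReal_nonneg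

lemma integrableOn_density_mul_exp [IsProbabilityMeasure P] (hρ0 : 0 < ρ) (hρ1 : ρ < 1)
    (hQ : IsTaggedQueue P ρ X E) {θ : ℂ} (hw : 2 * √ρ < (1 + ρ + θ).re) (n : ℕ) :
    IntegrableOn (fun t : ℝ => (density P ρ X E n t : ℂ) * Complex.exp (-θ * t)) (Ioi 0) := by
  have h := integrable_exp_condLaw hρ0 hρ1 hQ hw n
  rw [condLaw_eq_withDensity hρ0 hρ1 hQ, integrable_withDensity_iff_integrable_smul'
    (measurable_density n).ennreal_ofReal (ae_of_all _ fun _ => ENNReal.ofReal_lt_top)] at h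
  simp only [ENNReal.toReal_ofReal (density_nonneg n _), Complex.real_smul] at h
  exact h

lemma laplace_density [IsProbabilityMeasure P] (hρ0 : 0 < ρ) (hρ1 : ρ < 1)
    (hQ : IsTaggedQueue P ρ X E) {θ : ℂ} (hw : 2 * √ρ < (1 + ρ + θ).re) (n : ℕ) :
    laplace (density P ρ X E n) θ = exitTransform ρ θ n := by
  rw [← integral_exp_condLaw hρ0 hρ1 hQ hw, condLaw_eq_withDensity hρ0 hρ1 hQ,
    integral_withDensity_eq_integral_toReal_smul (measurable_density n).ennreal_ofReal
      (ae_of_all _ fun _ => ENNReal.ofReal_lt_top)]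
  simp only [laplace, ENNReal.toReal_ofReal (density_nonneg n _), Complex.real_smul]

end Queue

end MM1PS

theorem theorem2p1 {Ω : Type*} [MeasurableSpace Ω] (P : Measure Ω) [IsProbabilityMeasure P]
    (ρ : ℝ) (hρ0 : 0 < ρ) (hρ1 : ρ < 1) (X : ℕ → Ω → MM1PS.State) (E : ℕ → Ω → ℝ)
    (hQ : MM1PS.IsTaggedQueue P ρ X E) :
    -- the sojourn time is a.s. finite and its conditional laws have densities on the half-line
    (∀ᵐ ω ∂P, MM1PS.sojournTime ρ X E ω < ∞) ∧
    (∀ n, MM1PS.condLaw P ρ X E n =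
      (volume.restrict (Ioi 0)).withDensity
        (fun t => ENNReal.ofReal (MM1PS.density P ρ X E n t))) ∧
    ∀ θ : ℂ, -(1 - √ρ) ^ 2 < θ.re →
      -- the Laplace transforms converge
      (∀ n, IntegrableOn
        (fun t : ℝ => (MM1PS.density P ρ X E n t : ℂ) * Complex.exp (-θ * t)) (Ioi 0)) ∧
      -- they are the solution of the recurrence of admissible growth
      MM1PS.SolvesRecurrence ρ θ (fun n => MM1PS.laplace (MM1PS.density P ρ X E n) θ) ∧
      (∃ C : ℝ, ∀ n, ‖MM1PS.laplace (MM1PS.density P ρ X E n) θ‖ * √ρ ^ n ≤ C) ∧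
      (∀ q : ℕ → ℂ, MM1PS.SolvesRecurrence ρ θ q → (∃ C : ℝ, ∀ n, ‖q n‖ * √ρ ^ n ≤ C) →
        ∀ n, q n = MM1PS.laplace (MM1PS.density P ρ X E n) θ) ∧
      -- the integrals and the series in the explicit formula converge
      (∀ n, IntervalIntegrable
        (fun s : ℝ => MM1PS.gIntegrand ρ θ n (s * MM1PS.zMinus ρ θ) * MM1PS.zMinus ρ θ)
        volume 0 1) ∧
      Summable (fun l : ℕ => (ρ : ℂ) ^ l * MM1PS.G ρ θ l) ∧
      -- the explicit formula, for every admissible contour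
      ∀ γ : ℝ → ℂ, MM1PS.IsContourAround γ (MM1PS.zMinus ρ θ) (MM1PS.zPlus ρ θ) → ∀ n : ℕ,
        MM1PS.laplace (MM1PS.density P ρ X E n) θ =
          MM1PS.M ρ θ * MM1PS.G ρ θ n *
              ∑ l ∈ Finset.range (n + 1), (ρ : ℂ) ^ l * MM1PS.H ρ θ γ l +
            MM1PS.M ρ θ * MM1PS.H ρ θ γ n *
              ∑' k : ℕ, (ρ : ℂ) ^ (n + 1 + k) * MM1PS.G ρ θ (n + 1 + k) := by
  refine ⟨MM1PS.ae_sojournTime_lt_top hρ0 hρ1 hQ, MM1PS.condLaw_eq_withDensity hρ0 hρ1 hQ,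
    fun θ hθ => ?_⟩
  have hw := MM1PS.two_sqrt_lt_re hρ0 hθ
  have hsol := MM1PS.solvesRecurrence_exitTransform hρ0 hρ1 hw
  have hgrowth := MM1PS.exists_norm_exitTransform_le hρ0 hρ1 hw
  simp only [MM1PS.laplace_density hρ0 hρ1 hQ hw]
  exact ⟨MM1PS.integrableOn_density_mul_exp hρ0 hρ1 hQ hw, hsol, hgrowth,
    fun q hq hqC => MM1PS.recurrence_unique hρ0 hw hsol hq hgrowth hqC,
    MM1PS.intervalIntegrable_gIntegrand hρ0 hw, MM1PS.summable_G hρ0 hρ1 hw,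
    fun γ hγ => MM1PS.explicit_formula hρ0 hρ1 hw hsol hgrowth hγ⟩
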